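/- Let $\mathcal M\in\mathbb R^{m_1\times\cdots\times m_N}$ be a tensor, $\Omega$ a set of (observed) index tuples with complement $\Omega^c$, and let $\mathcal P_S$ keep the entries indexed by $S$ and set all others to zero. Let $r_1,\dots,r_N\ge 1$. For $\mathbf A=(\mathbf A_1,\dots,\mathbf A_N)$ with $\mathbf A_n\in\mathbb R^{m_n\times r_n}$ and a tensor $\mathcal X$ of the same size as $\mathcal M$, write $\times_n$ for the mode-$n$ product, $\mathrm{unfold}_n$ for the mode-$n$ matricization, and consider the incomplete-HOSVD problem $$\min_{\mathbf A,\mathcal X}\ g(\mathbf A,\mathcal X)=\tfrac12\big\|\mathcal X\times_1\mathbf A_1\mathbf A_1^\top\cdots\times_N\mathbf A_N\mathbf A_N^\top-\mathcal X\big\|_F^2\quad\text{s.t. } \mathbf A_n^\top\mathbf A_n=\mathbf I\ (n=1,\dots,N),\ \ \mathcal P_\Omega(\mathcal X)=\mathcal P_\Omega(\mathcal M).$$ Its Lagrangian is $$\mathcal L_g(\mathbf A,\mathcal X,\boldsymbol\Lambda,\mathcal Y)=g(\mathbf A,\mathcal X)+\tfrac12\sum_{n}\langle\boldsymbol\Lambda_n,\mathbf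 A_n^\top\mathbf A_n-\mathbf I\rangle+\langle\mathcal Y,\mathcal P_\Omega(\mathcal X)-\mathcal P_\Omega(\mathcal M)\rangle$$ with symmetric $\boldsymbol\Lambda_n\in\mathbb R^{r_n\times r_n}$, and its KKT conditions are $$\mathbf G_n\mathbf G_n^\top\mathbf A_n-\mathbf A_n\boldsymbol\Lambda_n=\mathbf 0,\quad \mathcal X-\mathcal X\times_{i=1}^N\mathbf A_i\mathbf A_i^\top+\mathcal P_\Omega(\mathcal Y)=\mathbf 0,\quad \mathbf A_n^\top\mathbf A_n-\mathbf I=\mathbf 0,\quad \mathcal P_\Omega(\mathcal X)-\mathcal P_\Omega(\mathcal M)=\mathbf 0\qquad(\mathrm{KKT})$$ for $n=1,\dots,N$, where $\mathbf G_n=\mathrm{unfold}_n(\mathcal X\times_{i\neq n}\mathbf A_i^\top)$. Let $(\mathbf A^k,\mathcal X^k)_{k\ge0}$ be generated by the incomplete higher-order orthogonality iteration (iHOOI): $(\mathbf A_n^0)^\top\mathbf A_n^0=\mathbf I$ for all $n$ and $\mathcal P_\Omega(\mathcal X^0)=\mathcal P_\Omega(\mathcal M)$; for $k=0,1,\dots$,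 successively for $n=1,\dots,N$, the columns of $\mathbf A_n^{k+1}$ are $r_n$ leading left singular vectors of $$\mathbf G_n^k=\mathrm{unfold}_n\big(\mathcal X^k\times_{i=1}^{n-1}(\mathbf A_i^{k+1})^\top\times_{i=n+1}^N(\mathbf A_i^k)^\top\big),$$ and then $\mathcal P_\Omega(\mathcal X^{k+1})=\mathcal P_\Omega(\mathcal X^k)$ and $\mathcal P_{\Omega^c}(\mathcal X^{k+1})=\mathcal P_{\Omega^c}\big(\mathcal X^k\times_{i=1}^N\mathbf A_i^{k+1}(\mathbf A_i^{k+1})^\top\big)$. Let $\sigma_i$ denote the $i$-th largest singular value ($0$ beyond the size of the matrix), and assume, with the convention $0/0=0$, $$\limsup_{k\to\infty}\frac{\sigma_{r_n+1}(\mathbf G_n^k)}{\sigma_{r_n}(\mathbf G_n^k)}<1\qquad\text{for every mode } n.$$ (1) For every finite limit point $(\bar{\mathbf A},\bar{\mathcal X})$ of $(\mathbf A^k,\mathcal X^k)$ there are multipliers $\bar{\boldsymbol\Lambda}$ (symmetric) and $\bar{\mathcal Y}$ such that $(\bar{\mathbf A},\bar{\mathcal X},\bar{\boldsymbol\Lambda},\bar{\mathcal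 Y})$ satisfies (KKT). (2) If $\{\mathcal P_{\Omega^c}(\mathcal X^k)\}_k$ is bounded, then there are multiplier sequences $\boldsymbol\Lambda^k$ (symmetric) and $\mathcal Y^k$ with $\lim_{k\to\infty}\nabla\mathcal L_g(\mathbf A^k,\mathcal X^k,\boldsymbol\Lambda^k,\mathcal Y^k)=\mathbf 0$; likewise there are multiplier sequences (possibly with other $\boldsymbol\Lambda^k$) along which the left-hand sides of all equations in (KKT) at $(\mathbf A^k,\mathcal X^k,\boldsymbol\Lambda^k,\mathcal Y^k)$ tend to $\mathbf 0$. (3) In particular, if all entries are observed (the higher-order orthogonality iteration, HOOI), then $\mathcal X^k=\mathcal M$ for all $k$, every limit point $\bar{\mathbf A}$ of $(\mathbf A^k)$ satisfies, together with $\bar{\mathcal X}=\mathcal M$ and suitable multipliers, (KKT), and the conclusion of (2) holds with no further assumption. -/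

import Mathlib

open Filter Topology
open scoped Matrix

noncomputable section

namespace IHOOI

variable {N : ℕ} {m p r : Fin N → ℕ}

/-- Real `N`-way tensors of size `m 0 × ⋯ × m (N - 1)`. -/
abbrev Tensor (m : Fin N → ℕ) : Type := (∀ l, Fin (m l)) → ℝ

/-- Families of matrices, one `p n × m n` matrix for each mode `n`. -/
abbrev MatFamily (p m : Fin N → ℕ) : Type := ∀ n, Matrix (Fin (p n)) (Fin (m n)) ℝ

/-- The inner product of tensors; `tinner X X` is the squared Frobenius norm of `X`. -/
def tinner (X Y : Tensor m) : ℝ := ∑ i, X i * Y i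

/-- The Frobenius inner product of matrices. -/
def minner {a b : ℕ} (B C : Matrix (Fin a) (Fin b) ℝ) : ℝ := ∑ i, ∑ j, B i j * C i j

/-- The multiple mode product `X ×₁ B₁ ⋯ ×_N B_N`, componentwise. -/
def multiProd (X : Tensor m) (B : MatFamily p m) : Tensor p :=
  fun j => ∑ i : (∀ l, Fin (m l)), (∏ l, B l (j l) (i l)) * X i

/-- The column index set of a mode-`n` matricization: all indices but the `n`-th one. -/
abbrev ColIdx (p : Fin N → ℕ) (n : Fin N) : Type := ∀ l : {l : Fin N // l ≠ n}, Fin (p l)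

/-- The mode-`n` matricization of `X`: its columns are the mode-`n` fibers of `X`. -/
def matricize (n : Fin N) (X : Tensor m) : Matrix (Fin (m n)) (ColIdx m n) ℝ :=
  Matrix.of fun a j => X ((Equiv.piSplitAt n fun l => Fin (m l)).symm (a, j))

/-- The mode-`n` matricization of the product of `X` with `B_i` in every mode `i ≠ n`. -/
def matricizeProd (n : Fin N) (X : Tensor m) (B : MatFamily p m) :
    Matrix (Fin (m n)) (ColIdx p n) ℝ :=
  Matrix.of fun a j =>
    ∑ i : ColIdx m n, (∏ l : {l : Fin N // l ≠ n}, B l (j l) (i l)) * matricize n X a i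

/-- `G_n = unfold_n (X ×_{i ≠ n} A_iᵀ)`. -/
def gMat (n : Fin N) (X : Tensor m) (A : MatFamily m r) : Matrix (Fin (m n)) (ColIdx r n) ℝ :=
  matricizeProd n X fun i => (A i)ᵀ

/-- `X ×_{i=1}^N (A_i A_iᵀ)`. -/
def compress (X : Tensor m) (A : MatFamily m r) : Tensor m :=
  multiProd X fun i => A i * (A i)ᵀ

/-- The projection that keeps the entries in `S` and replaces all others by zero. -/
def mask (S : Set (∀ l, Fin (m l))) (X : Tensor m) : Tensor m := S.indicator X

/-- `σ_i(G)`, the `i`-th largest singular value of `G`, for `i = 1, 2, …`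
(zero beyond the size of `G`). -/
def sigma {a : ℕ} {c : Type} [Fintype c] [DecidableEq c] (G : Matrix (Fin a) c ℝ) (i : ℕ) : ℝ :=
  (Matrix.toEuclideanLin G).singularValues (i - 1)

/-- The columns of `U` are the leading `s` left singular vectors of `G` (in some order): they are
orthonormal eigenvectors of `G Gᵀ` for the eigenvalues `σ_1(G)², …, σ_s(G)²`. -/
def IsLeadingLeft {a s : ℕ} {c : Type} [Fintype c] [DecidableEq c]
    (G : Matrix (Fin a) c ℝ) (U : Matrix (Fin a) (Fin s) ℝ) : Prop :=
  Uᵀ * U = 1 ∧ ∃ e : Equiv.Perm (Fin s),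
    G * Gᵀ * U = U * Matrix.diagonal fun j => sigma G ((e j : ℕ) + 1) ^ 2

/-- The matrix `G_n^k` of the iteration: modes before `n` use the new factors, modes after `n`
the old ones. -/
def gIter (A : ℕ → MatFamily m r) (X : ℕ → Tensor m) (k : ℕ) (n : Fin N) :
    Matrix (Fin (m n)) (ColIdx r n) ℝ :=
  gMat n (X k) fun i => if i < n then A (k + 1) i else A k i

/-- `(A^k, X^k)` is a sequence generated by the incomplete higher-order orthogonality iteration
from the entries of `M` in `Ω` and a feasible initial point. -/
structure IsIHOOI (Ω : Set (∀ l, Fin (m l))) (M : Tensor m)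
    (A : ℕ → MatFamily m r) (X : ℕ → Tensor m) : Prop where
  init_orth : ∀ n, (A 0 n)ᵀ * A 0 n = 1
  init_obs : mask Ω (X 0) = mask Ω M
  factor_step : ∀ k n, IsLeadingLeft (gIter A X k n) (A (k + 1) n)
  obs_step : ∀ k, mask Ω (X (k + 1)) = mask Ω (X k)
  fill_step : ∀ k, mask Ωᶜ (X (k + 1)) = mask Ωᶜ (compress (X k) (A (k + 1)))

/-- The objective `g(A, X) = ½ ‖X ×_i (A_i A_iᵀ) - X‖_F²`. -/
def objective (A : MatFamily m r) (X : Tensor m) : ℝ :=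
  1 / 2 * tinner (compress X A - X) (compress X A - X)

/-- The space of primal and dual variables `(A, X, Λ, Y)`. -/
abbrev PrimalDual (m r : Fin N → ℕ) : Type :=
  MatFamily m r × Tensor m × MatFamily r r × Tensor m

/-- The Lagrangian `L_g(A, X, Λ, Y)`. -/
def lagrangian (Ω : Set (∀ l, Fin (m l))) (M : Tensor m) (z : PrimalDual m r) : ℝ :=
  objective z.1 z.2.1 + 1 / 2 * ∑ n, minner (z.2.2.1 n) ((z.1 n)ᵀ * z.1 n - 1)
    + tinner z.2.2.2 (mask Ω z.2.1 - mask Ω M)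

/-- The gradient `∇L_g` with respect to all of `A, X, Λ, Y`: the array of all partial derivatives
of the (polynomial) function `L_g`. -/
def gradLagrangian (Ω : Set (∀ l, Fin (m l))) (M : Tensor m) (z : PrimalDual m r) :
    PrimalDual m r :=
  (fun n => Matrix.of fun i j =>
      lineDeriv ℝ (lagrangian Ω M) z (Pi.single n (Matrix.single i j 1), 0, 0, 0),
   fun i => lineDeriv ℝ (lagrangian Ω M) z (0, Pi.single i 1, 0, 0),
   fun n => Matrix.of fun i j =>
      lineDeriv ℝ (lagrangian Ω M) z (0, 0, Pi.single n (Matrix.single i j 1), 0),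
   fun i => lineDeriv ℝ (lagrangian Ω M) z (0, 0, 0, Pi.single i 1))

/-- The left-hand sides of the KKT system. -/
def kktResidual (Ω : Set (∀ l, Fin (m l))) (M : Tensor m) (z : PrimalDual m r) :
    PrimalDual m r :=
  (fun n => gMat n z.2.1 z.1 * (gMat n z.2.1 z.1)ᵀ * z.1 n - z.1 n * z.2.2.1 n,
   z.2.1 - compress z.2.1 z.1 + mask Ω z.2.2.2,
   fun n => (z.1 n)ᵀ * z.1 n - 1,
   mask Ω z.2.1 - mask Ω M)

/-- `(A, X, Λ, Y)`, with symmetric multipliers `Λ_n`, satisfies the KKT conditions. -/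
def IsKKT (Ω : Set (∀ l, Fin (m l))) (M : Tensor m) (A : MatFamily m r) (X : Tensor m)
    (Λ : MatFamily r r) (Y : Tensor m) : Prop :=
  (∀ n, (Λ n).IsSymm) ∧ kktResidual Ω M (A, X, Λ, Y) = 0

/-- There are multiplier sequences, with symmetric `Λ_n^k`, along which the gradient of the
Lagrangian tends to zero, and multiplier sequences along which the residual of the KKT system
tends to zero. (Off the orthonormality constraint `g` differs from
`½ (‖X‖² - ‖X ×_i A_iᵀ‖²)`, from which the KKT system is derived; the two gradients in `A_n`
differ by a shift of `Λ_n`.) -/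
def AsymptoticallyStationary (Ω : Set (∀ l, Fin (m l))) (M : Tensor m)
    (A : ℕ → MatFamily m r) (X : ℕ → Tensor m) : Prop :=
  (∃ (Λ : ℕ → MatFamily r r) (Y : ℕ → Tensor m), (∀ k n, (Λ k n).IsSymm) ∧
      Tendsto (fun k => gradLagrangian Ω M (A k, X k, Λ k, Y k)) atTop (𝓝 0)) ∧
  (∃ (Λ : ℕ → MatFamily r r) (Y : ℕ → Tensor m), (∀ k n, (Λ k n).IsSymm) ∧
      Tendsto (fun k => kktResidual Ω M (A k, X k, Λ k, Y k)) atTop (𝓝 0))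

end IHOOI

end

noncomputable section

namespace IHOOI

variable {N : ℕ} {m p q r : Fin N → ℕ}

/-! With orthonormal factors `compress` is an orthogonal projection, so the objective is half of
`‖X‖² - ⟨X, compress X A⟩`, and in a single mode `n` the inner product is `tr(A_n A_nᵀ G Gᵀ)`. Let
`P` and `Q` be the new and old projectors in mode `n`, and `G = gIter A X k n`. Since `P` commutes
with `G Gᵀ`, the gain of the update is `‖(1 - Q) P G‖² - ‖Q (1 - P) G‖²`
(`IsLeadingLeft.trace_sub_trace`), and a gap ratio at most `κ` makes the second term at most `κ²`
times the first (`IsLeadingLeft.frobSq_le`). The fill step lowers the objective by at least `½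
‖X^{k+1} - X^k‖²` (`objective_fill_le`). As the objective is bounded below, all these quantities
tend to zero.

Consecutive factors need not approach each other, so the limit keeps two families: along an
ultrafilter `A^k → B`, `X^k → Y`, and by compactness `A^{k+1} → C`. In the limit `(1 - Q) P G = 0`
and `Q (1 - P) G = 0`, hence `P G = Q G`, and exchanging `B_n` for `C_n` mode by mode leaves the
compression of `Y` unchanged. This carries the eigenspace property of `C_n`, which concerns mixed
factors, over to `B` (`isStationary_of_hybrid`).

Explicit multipliers turn stationarity into the KKT system. For bounded iterates the residuals are
continuous along convergent ultrafilters and vanish at their stationary limits, so they tend to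
zero. -/

/-! ### Mode products, matricization and Kronecker products. -/

/-- The Kronecker product of the matrices `B_i` with `i ≠ n`. -/
def kron (n : Fin N) (B : MatFamily p m) : Matrix (ColIdx p n) (ColIdx m n) ℝ :=
  Matrix.of fun j i => ∏ l : {l : Fin N // l ≠ n}, B l (j l) (i l)

lemma kron_congr {n : Fin N} {B C : MatFamily p m} (h : ∀ l, l ≠ n → B l = C l) :
    kron n B = kron n C := by
  ext j i
  simp only [kron, Matrix.of_apply]
  exact Finset.prod_congr rfl fun l _ => by rw [h l l.2]

lemma kron_mul (n : Fin N) (B : MatFamily p m) (C : MatFamily m q) :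
    kron n B * kron n C = kron n fun l => B l * C l := by
  ext j i
  simp only [kron, Matrix.mul_apply, Matrix.of_apply, Finset.prod_univ_sum, Fintype.piFinset_univ,
    Finset.prod_mul_distrib]

lemma kron_transpose (n : Fin N) (B : MatFamily p m) :
    (kron n B)ᵀ = kron n fun l => (B l)ᵀ := rfl

lemma prod_one_apply {ι : Type*} [Fintype ι] [DecidableEq ι] {κ : ι → Type*}
    [∀ i, DecidableEq (κ i)] (x y : ∀ i, κ i) :
    (∏ i, (1 : Matrix (κ i) (κ i) ℝ) (x i) (y i)) = if x = y then 1 else 0 := by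
  simp only [Matrix.one_apply, Finset.prod_ite_zero, Finset.prod_const_one, funext_iff,
    Finset.mem_univ, true_imp_iff]

lemma kron_one (n : Fin N) : kron n (fun l => (1 : Matrix (Fin (m l)) (Fin (m l)) ℝ)) = 1 := by
  ext j i
  simp only [kron, Matrix.of_apply, Matrix.one_apply (n := ColIdx m n)]
  exact prod_one_apply j i

lemma matricizeProd_eq (n : Fin N) (X : Tensor m) (B : MatFamily p m) :
    matricizeProd n X B = matricize n X * (kron n B)ᵀ := by
  ext a j
  simp only [matricizeProd, Matrix.of_apply, Matrix.mul_apply, kron, Matrix.transpose_apply]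
  exact Finset.sum_congr rfl fun i _ => mul_comm _ _

lemma gMat_eq (n : Fin N) (X : Tensor m) (A : MatFamily m r) :
    gMat n X A = matricize n X * kron n A := by
  rw [gMat, matricizeProd_eq, kron_transpose]; rfl

lemma sum_split (n : Fin N) (f : (∀ l, Fin (m l)) → ℝ) :
    ∑ i, f i = ∑ a, ∑ j, f ((Equiv.piSplitAt n fun l => Fin (m l)).symm (a, j)) := by
  rw [← Fintype.sum_prod_type', ← (Equiv.piSplitAt n fun l => Fin (m l)).symm.sum_comp]

lemma prod_split (n : Fin N) (B : MatFamily p m) (b : Fin (p n)) (j : ColIdx p n)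
    (a : Fin (m n)) (i : ColIdx m n) :
    (∏ l, B l ((Equiv.piSplitAt n fun l => Fin (p l)).symm (b, j) l)
      ((Equiv.piSplitAt n fun l => Fin (m l)).symm (a, i) l)) = B n b a * kron n B j i := by
  rw [Fintype.prod_eq_mul_prod_subtype_ne _ n]
  simp only [kron, Matrix.of_apply]
  congr 1
  · simp
  · refine Finset.prod_congr rfl fun l _ => ?_
    simp [Equiv.piSplitAt, l.2]

/-- Isolates mode `n`: all other modes act on the right through one Kronecker matrix, which reduces
tensor statements to matrix algebra. -/
lemma matricize_multiProd (n : Fin N) (X : Tensor m) (B : MatFamily p m) :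
    matricize n (multiProd X B) = B n * matricize n X * (kron n B)ᵀ := by
  ext b j
  simp only [matricize, Matrix.of_apply, multiProd, Matrix.mul_apply, Matrix.transpose_apply]
  rw [sum_split n, Finset.sum_comm]
  refine Finset.sum_congr rfl fun i _ => ?_
  rw [Finset.sum_mul]
  refine Finset.sum_congr rfl fun a _ => ?_
  rw [prod_split]; ring

lemma matricize_injective (n : Fin N) :
    Function.Injective (matricize n : Tensor m → Matrix (Fin (m n)) (ColIdx m n) ℝ) := by
  intro X Y h
  ext i
  have := congrFun (congrFun h (i n)) fun l => i l
  have e : (Equiv.piSplitAt n fun l => Fin (m l)).symm (i n, fun l => i l) = i :=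
    (Equiv.piSplitAt n fun l => Fin (m l)).symm_apply_apply i
  simpa only [matricize, Matrix.of_apply, e] using this

lemma matricize_sub (n : Fin N) (X Y : Tensor m) :
    matricize n (X - Y) = matricize n X - matricize n Y := rfl

lemma tinner_eq_trace (n : Fin N) (X Y : Tensor m) :
    tinner X Y = (matricize n X * (matricize n Y)ᵀ).trace := by
  simp only [tinner, matricize, Matrix.trace, Matrix.diag, Matrix.mul_apply, Matrix.of_apply,
    Matrix.transpose_apply]
  rw [sum_split n]

lemma multiProd_multiProd (X : Tensor m) (B : MatFamily p m) (C : MatFamily q p) :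
    multiProd (multiProd X B) C = multiProd X fun l => C l * B l := by
  ext j
  simp only [multiProd, Matrix.mul_apply, Finset.prod_univ_sum, Fintype.piFinset_univ,
    Finset.prod_mul_distrib, Finset.mul_sum, Finset.sum_mul]
  rw [Finset.sum_comm]
  exact Finset.sum_congr rfl fun i _ => Finset.sum_congr rfl fun k _ => by ring

lemma tinner_multiProd (X : Tensor m) (Y : Tensor p) (B : MatFamily p m) :
    tinner (multiProd X B) Y = tinner X (multiProd Y fun l => (B l)ᵀ) := by
  simp only [tinner, multiProd, Finset.mul_sum, Finset.sum_mul, Matrix.transpose_apply]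
  rw [Finset.sum_comm]
  exact Finset.sum_congr rfl fun i _ => Finset.sum_congr rfl fun k _ => by ring

lemma multiProd_sub (X Y : Tensor m) (B : MatFamily p m) :
    multiProd (X - Y) B = multiProd X B - multiProd Y B := by
  ext j
  simp [multiProd, mul_sub]

lemma multiProd_add (X Y : Tensor m) (B : MatFamily p m) :
    multiProd (X + Y) B = multiProd X B + multiProd Y B := by
  ext j
  simp [multiProd, mul_add, Finset.sum_add_distrib]

lemma multiProd_smul (t : ℝ) (X : Tensor m) (B : MatFamily p m) :
    multiProd (t • X) B = t • multiProd X B := by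
  ext j
  simp only [multiProd, Pi.smul_apply, smul_eq_mul, Finset.mul_sum]
  exact Finset.sum_congr rfl fun i _ => by ring

/-! ### Inner product -/

lemma tinner_comm (X Y : Tensor m) : tinner X Y = tinner Y X := by
  simp only [tinner, mul_comm]

lemma tinner_add_left (X Y Z : Tensor m) : tinner (X + Y) Z = tinner X Z + tinner Y Z := by
  simp [tinner, add_mul, Finset.sum_add_distrib]

lemma tinner_sub_left (X Y Z : Tensor m) : tinner (X - Y) Z = tinner X Z - tinner Y Z := by
  simp [tinner, sub_mul]

lemma tinner_add_right (X Y Z : Tensor m) : tinner X (Y + Z) = tinner X Y + tinner X Z := by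
  simp [tinner, mul_add, Finset.sum_add_distrib]

lemma tinner_sub_right (X Y Z : Tensor m) : tinner X (Y - Z) = tinner X Y - tinner X Z := by
  simp [tinner, mul_sub]

lemma tinner_smul_left (t : ℝ) (X Y : Tensor m) : tinner (t • X) Y = t * tinner X Y := by
  simp [tinner, Finset.mul_sum, mul_assoc]

lemma tinner_smul_right (t : ℝ) (X Y : Tensor m) : tinner X (t • Y) = t * tinner X Y := by
  rw [tinner_comm, tinner_smul_left, tinner_comm]

lemma tinner_self_nonneg (X : Tensor m) : 0 ≤ tinner X X :=
  Finset.sum_nonneg fun i _ => mul_self_nonneg (X i)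

/-! ### Compression by orthonormal factors -/

lemma compress_sub (X Y : Tensor m) (A : MatFamily m r) :
    compress (X - Y) A = compress X A - compress Y A := multiProd_sub X Y _

lemma compress_add (X Y : Tensor m) (A : MatFamily m r) :
    compress (X + Y) A = compress X A + compress Y A := multiProd_add X Y _

lemma compress_smul (t : ℝ) (X : Tensor m) (A : MatFamily m r) :
    compress (t • X) A = t • compress X A := multiProd_smul t X _

lemma tinner_compress (X Y : Tensor m) (A : MatFamily m r) :
    tinner (compress X A) Y = tinner X (compress Y A) := by
  simp only [compress, tinner_multiProd, Matrix.transpose_mul, Matrix.transpose_transpose]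

lemma proj_mul_proj {a s : ℕ} {U : Matrix (Fin a) (Fin s) ℝ} (hU : Uᵀ * U = 1) :
    U * Uᵀ * (U * Uᵀ) = U * Uᵀ := by
  rw [Matrix.mul_assoc, ← Matrix.mul_assoc Uᵀ, hU, Matrix.one_mul]

lemma compress_compress (X : Tensor m) {A : MatFamily m r} (hA : ∀ n, (A n)ᵀ * A n = 1) :
    compress (compress X A) A = compress X A := by
  simp only [compress, multiProd_multiProd, proj_mul_proj (hA _)]

/-- Pythagoras: compression is self-adjoint and idempotent, so `‖compress X A‖² = ⟨X, compress X
A⟩`. -/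
lemma objective_eq (X : Tensor m) {A : MatFamily m r} (hA : ∀ n, (A n)ᵀ * A n = 1) :
    objective A X = 1 / 2 * (tinner X X - tinner X (compress X A)) := by
  have h : tinner (compress X A) (compress X A) = tinner X (compress X A) := by
    rw [tinner_compress, compress_compress X hA]
  rw [objective, tinner_sub_left, tinner_sub_right, tinner_sub_right, h,
    tinner_comm (compress X A) X]
  ring

lemma matricize_compress (n : Fin N) (X : Tensor m) (A : MatFamily m r) :
    matricize n (compress X A) = A n * (A n)ᵀ * (gMat n X A * (kron n A)ᵀ) := by
  rw [compress, matricize_multiProd, ← kron_mul n A fun l => (A l)ᵀ, Matrix.transpose_mul,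
    ← kron_transpose, Matrix.transpose_transpose, gMat_eq]
  simp only [Matrix.mul_assoc]

lemma kron_orthonormal (n : Fin N) {A : MatFamily m r} (hA : ∀ n, (A n)ᵀ * A n = 1) :
    (kron n A)ᵀ * kron n A = 1 := by
  rw [kron_transpose, kron_mul]
  simp only [hA, kron_one]

/-- The right-hand side depends on `A` only through the compression of `X`; two families with the
same compression therefore share it. -/
lemma matricize_mul_matricize_compress (n : Fin N) (X : Tensor m) (A : MatFamily m r) :
    matricize n X * (matricize n (compress X A))ᵀ =
      gMat n X A * (gMat n X A)ᵀ * (A n * (A n)ᵀ) := by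
  rw [matricize_compress]
  simp only [Matrix.transpose_mul, Matrix.transpose_transpose, gMat_eq, Matrix.mul_assoc]

lemma tinner_self_compress (n : Fin N) (X : Tensor m) (A : MatFamily m r) :
    tinner X (compress X A) = (A n * (A n)ᵀ * (gMat n X A * (gMat n X A)ᵀ)).trace := by
  rw [tinner_eq_trace n, matricize_mul_matricize_compress, Matrix.trace_mul_comm]

lemma gMat_congr {n : Fin N} {X : Tensor m} {A B : MatFamily m r} (h : ∀ l, l ≠ n → A l = B l) :
    gMat n X A = gMat n X B := by
  rw [gMat_eq, gMat_eq, kron_congr h]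

/-! ### Leading left singular vectors and a min-max bound. -/

section LeadingSubspace

variable {a s : ℕ} {c : Type} [Fintype c] [DecidableEq c]

lemma sigma_nonneg (G : Matrix (Fin a) c ℝ) (i : ℕ) : 0 ≤ sigma G i :=
  LinearMap.singularValues_nonneg _ _

lemma sigma_anti (G : Matrix (Fin a) c ℝ) {i j : ℕ} (h : i ≤ j) : sigma G j ≤ sigma G i :=
  LinearMap.singularValues_antitone _ (Nat.sub_le_sub_right h 1)

lemma dotProduct_self_eq_norm_sq {ι : Type*} [Fintype ι] (w : ι → ℝ) :
    w ⬝ᵥ w = ‖WithLp.toLp 2 w‖ ^ 2 := by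
  rw [EuclideanSpace.norm_sq_eq]
  simp [dotProduct, sq]

/-- A right singular basis of `G`. -/
lemma exists_right_singular_basis (G : Matrix (Fin a) c ℝ) :
    ∃ f : Fin (Fintype.card c) → c → ℝ, ∀ w : c → ℝ,
      w ⬝ᵥ w = ∑ i, (f i ⬝ᵥ w) ^ 2 ∧
      (G *ᵥ w) ⬝ᵥ (G *ᵥ w) = ∑ i : Fin (Fintype.card c), sigma G (i + 1) ^ 2 * (f i ⬝ᵥ w) ^ 2 := by
  set T := Matrix.toEuclideanLin G
  have hn : Module.finrank ℝ (EuclideanSpace ℝ c) = Fintype.card c := finrank_euclideanSpace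
  set b := T.isSymmetric_adjoint_comp_self.eigenvectorBasis hn with hb
  have inner_eq : ∀ i (w : c → ℝ), inner ℝ (b i) (WithLp.toLp 2 w) = (b i).ofLp ⬝ᵥ w := by
    intro i w
    simp [EuclideanSpace.inner_eq_star_dotProduct, dotProduct_comm]
  refine ⟨fun i => (b i).ofLp, fun w => ⟨?_, ?_⟩⟩
  · rw [dotProduct_self_eq_norm_sq, ← b.sum_sq_norm_inner_right]
    exact Finset.sum_congr rfl fun i _ => by rw [inner_eq, Real.norm_eq_abs, sq_abs]
  · have h1 : WithLp.toLp 2 (G *ᵥ w) = T (WithLp.toLp 2 w) := rfl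
    rw [dotProduct_self_eq_norm_sq, h1, ← real_inner_self_eq_norm_sq,
      ← LinearMap.adjoint_inner_right, ← b.sum_inner_mul_inner]
    refine Finset.sum_congr rfl fun i _ => ?_
    have h2 : inner ℝ (b i) ((LinearMap.adjoint T) (T (WithLp.toLp 2 w))) =
        sigma G (i + 1) ^ 2 * inner ℝ (b i) (WithLp.toLp 2 w) := by
      have h3 : (LinearMap.adjoint T) (T (WithLp.toLp 2 w)) =
        (LinearMap.adjoint T ∘ₗ T) (WithLp.toLp 2 w) := rfl
      rw [h3, ← T.isSymmetric_adjoint_comp_self, hb,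
        LinearMap.IsSymmetric.apply_eigenvectorBasis, real_inner_smul_left]
      simp only [sigma, Nat.add_sub_cancel]
      rw [← LinearMap.sq_singularValues_fin T hn i]
      rfl
    rw [h2, real_inner_comm, inner_eq]; ring

lemma dotProduct_transpose_mulVec {α β : Type*} [Fintype α] [Fintype β] (G : Matrix α β ℝ) (x y : α → ℝ) :
    (Gᵀ *ᵥ x) ⬝ᵥ (Gᵀ *ᵥ y) = x ⬝ᵥ ((G * Gᵀ) *ᵥ y) := by
  rw [← Matrix.mulVec_mulVec, Matrix.dotProduct_mulVec x, Matrix.mulVec_transpose]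

/-- On the orthogonal complement of `s` leading left singular vectors, `Gᵀ` is bounded by
`σ_{s+1}(G)`. -/
lemma IsLeadingLeft.bound_compl {G : Matrix (Fin a) c ℝ} {U : Matrix (Fin a) (Fin s) ℝ}
    (hU : IsLeadingLeft G U) {x : Fin a → ℝ} (hx : Uᵀ *ᵥ x = 0) :
    (Gᵀ *ᵥ x) ⬝ᵥ (Gᵀ *ᵥ x) ≤ sigma G (s + 1) ^ 2 * (x ⬝ᵥ x) := by
  obtain ⟨hUU, e, hD⟩ := hU
  -- Dimension count as in Courant–Fischer. The eigenvalue equation for `U` alone would not exclude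
  -- a large singular vector orthogonal to `U`; the count uses that the columns of `U` exhaust all
  -- singular values above `τ`, with multiplicity.
  by_contra! hlt
  set τ := sigma G (s + 1) with hτ
  have hτ0 : 0 ≤ τ := sigma_nonneg _ _
  obtain ⟨f, hf⟩ := exists_right_singular_basis G
  let J := {j : Fin s // τ < sigma G ((e j : ℕ) + 1)}
  let I := {i : Fin (Fintype.card c) // τ < sigma G ((i : ℕ) + 1)}
  -- A singular value strictly above `τ = σ_{s+1}` is among the first `s`, so `e` matches it with a
  -- column of `U`.
  have hIJ : Fintype.card I ≤ Fintype.card J := by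
    have hi : ∀ i : I, (i.1 : ℕ) < s := fun i => by
      by_contra! h
      exact absurd i.2 (not_lt.2 (sigma_anti G (by omega)))
    refine Fintype.card_le_of_injective
      (fun i : I => (⟨e.symm ⟨i.1, hi i⟩, by simpa using i.2⟩ : J)) ?_
    intro i i' h
    have h1 := congrArg Subtype.val h
    have h2 := congrArg Fin.val (e.symm.injective h1)
    exact Subtype.ext (Fin.ext h2)
  -- vectors in the span of `x` and the columns of `U` with singular value above `τ`
  let Y : ((Option J) → ℝ) →ₗ[ℝ] (Fin a → ℝ) :=
    { toFun := fun α => α none • x + U *ᵥ fun j => if h : _ then α (some ⟨j, h⟩) else 0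
      map_add' := by
        intro α β
        have : (fun j => if h : τ < sigma G ((e j : ℕ) + 1) then (α + β) (some ⟨j, h⟩) else 0) =
          (fun j => if h : τ < sigma G ((e j : ℕ) + 1) then α (some ⟨j, h⟩) else 0) +
          (fun j => if h : τ < sigma G ((e j : ℕ) + 1) then β (some ⟨j, h⟩) else 0) := by
          ext j; by_cases h : τ < sigma G ((e j : ℕ) + 1) <;> simp [h]
        rw [this, Matrix.mulVec_add, Pi.add_apply, add_smul]
        exact add_add_add_comm _ _ _ _
      map_smul' := by
        intro t α
        have : (fun j => if h : τ < sigma G ((e j : ℕ) + 1) then (t • α) (some ⟨j, h⟩) else 0) =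
          t • (fun j => if h : τ < sigma G ((e j : ℕ) + 1) then α (some ⟨j, h⟩) else 0) := by
          ext j; by_cases h : τ < sigma G ((e j : ℕ) + 1) <;> simp [h]
        rw [this, Matrix.mulVec_smul, Pi.smul_apply, smul_assoc, RingHom.id_apply, smul_add] }
  let Φ : ((Option J) → ℝ) →ₗ[ℝ] (I → ℝ) :=
    { toFun := fun α i => f i.1 ⬝ᵥ (Gᵀ *ᵥ Y α)
      map_add' := by intro α β; ext i; simp [Matrix.mulVec_add, dotProduct_add]
      map_smul' := by intro t α; ext i; simp [Matrix.mulVec_smul, dotProduct_smul] }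
  -- There are `|J| + 1` unknowns and only `|I| ≤ |J|` equations.
  have hker : LinearMap.ker Φ ≠ ⊥ := by
    apply LinearMap.ker_ne_bot_of_finrank_lt
    simp only [Module.finrank_fintype_fun_eq_card, Fintype.card_option]
    omega
  obtain ⟨α, hα, hα0⟩ := (Submodule.ne_bot_iff _).1 hker
  set β : Fin s → ℝ := fun j => if h : τ < sigma G ((e j : ℕ) + 1) then α (some ⟨j, h⟩) else 0
    with hβ
  set y := Y α with hy
  have hyd : y = α none • x + U *ᵥ β := rfl
  -- quadratic forms
  have hxU : ∀ γ : Fin s → ℝ, x ⬝ᵥ (U *ᵥ γ) = 0 := fun γ => by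
    rw [Matrix.dotProduct_mulVec, ← Matrix.mulVec_transpose, hx, zero_dotProduct]
  have hUU' : ∀ γ δ : Fin s → ℝ, (U *ᵥ γ) ⬝ᵥ (U *ᵥ δ) = γ ⬝ᵥ δ := fun γ δ => by
    rw [Matrix.dotProduct_mulVec, ← Matrix.mulVec_transpose, Matrix.mulVec_mulVec, hUU,
      Matrix.one_mulVec]
  have hyy : y ⬝ᵥ y = α none ^ 2 * (x ⬝ᵥ x) + β ⬝ᵥ β := by
    rw [hyd]
    simp only [add_dotProduct, dotProduct_add, smul_dotProduct, dotProduct_smul, hxU, hUU',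
      dotProduct_comm (U *ᵥ β) x, smul_eq_mul]
    ring
  set d : Fin s → ℝ := fun j => sigma G ((e j : ℕ) + 1) ^ 2 with hd
  have hGU : (G * Gᵀ) *ᵥ (U *ᵥ β) = U *ᵥ (fun j => d j * β j) := by
    rw [Matrix.mulVec_mulVec, hD, ← Matrix.mulVec_mulVec]
    congr 1
    ext j
    rw [Matrix.mulVec_diagonal]
  have hGG : (Gᵀ *ᵥ y) ⬝ᵥ (Gᵀ *ᵥ y) =
      α none ^ 2 * ((Gᵀ *ᵥ x) ⬝ᵥ (Gᵀ *ᵥ x)) + ∑ j, d j * β j ^ 2 := by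
    have h1 : (Gᵀ *ᵥ x) ⬝ᵥ (Gᵀ *ᵥ (U *ᵥ β)) = 0 := by
      rw [dotProduct_transpose_mulVec, hGU, hxU]
    have h2 : (Gᵀ *ᵥ (U *ᵥ β)) ⬝ᵥ (Gᵀ *ᵥ (U *ᵥ β)) = ∑ j, d j * β j ^ 2 := by
      rw [dotProduct_transpose_mulVec, hGU, hUU']
      exact Finset.sum_congr rfl fun j _ => by ring
    rw [hyd, Matrix.mulVec_add, Matrix.mulVec_smul]
    simp only [add_dotProduct, dotProduct_add, smul_dotProduct, dotProduct_smul, h1, h2,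
      dotProduct_comm (Gᵀ *ᵥ (U *ᵥ β)) (Gᵀ *ᵥ x), smul_eq_mul]
    ring
  have hterm : ∀ j, τ ^ 2 * β j ^ 2 ≤ d j * β j ^ 2 := by
    intro j
    by_cases h : τ < sigma G ((e j : ℕ) + 1)
    · exact mul_le_mul_of_nonneg_right (pow_le_pow_left₀ hτ0 h.le 2) (sq_nonneg _)
    · simp [hβ, h]
  -- strict inequality
  have hstrict : τ ^ 2 * (y ⬝ᵥ y) < (Gᵀ *ᵥ y) ⬝ᵥ (Gᵀ *ᵥ y) := by
    have hsum : τ ^ 2 * (β ⬝ᵥ β) ≤ ∑ j, d j * β j ^ 2 := by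
      rw [dotProduct, Finset.mul_sum]
      exact Finset.sum_le_sum fun j _ => by simpa [sq] using hterm j
    rw [hyy, hGG]
    -- Strictness comes from the column part if the coefficient of `x` vanishes, since the singular
    -- values indexed by `J` exceed `τ`, and from `hlt` otherwise.
    by_cases h0 : α none = 0
    · have : ∃ j, β j ≠ 0 ∧ τ < sigma G ((e j : ℕ) + 1) := by
        by_contra! hall
        apply hα0
        ext o
        rcases o with _ | ⟨j, hj⟩
        · exact h0
        · by_contra hne
          have : β j = α (some ⟨j, hj⟩) := by simp [hβ, hj]
          exact absurd (hall j (by rw [this]; exact hne)) (not_le.2 hj)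
      obtain ⟨j, hj0, hj⟩ := this
      have : τ ^ 2 * (β ⬝ᵥ β) < ∑ j, d j * β j ^ 2 := by
        rw [dotProduct, Finset.mul_sum]
        refine Finset.sum_lt_sum (fun j _ => by simpa [sq] using hterm j)
          ⟨j, Finset.mem_univ _, ?_⟩
        have hp : 0 < β j ^ 2 := by positivity
        have := mul_lt_mul_of_pos_right (pow_lt_pow_left₀ hj hτ0 two_ne_zero) hp
        rw [← sq]
        exact this
      rw [h0]; linarith
    · have hp : 0 < α none ^ 2 := by positivity
      have := mul_lt_mul_of_pos_left hlt hp
      linarith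
  -- upper bound from the right singular basis
  set w := Gᵀ *ᵥ y with hw
  have hGw : (G *ᵥ w) ⬝ᵥ (G *ᵥ w) ≤ τ ^ 2 * (w ⬝ᵥ w) := by
    rw [(hf w).1, (hf w).2, Finset.mul_sum]
    refine Finset.sum_le_sum fun i _ => ?_
    by_cases h : τ < sigma G ((i : ℕ) + 1)
    · have : f i ⬝ᵥ w = 0 := congrFun (LinearMap.mem_ker.1 hα) ⟨i, h⟩
      simp [this]
    · exact mul_le_mul_of_nonneg_right
        (pow_le_pow_left₀ (sigma_nonneg _ _) (not_lt.1 h) 2) (sq_nonneg _)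
  -- Cauchy–Schwarz for `‖w‖² = ⟨y, G w⟩`. With `hGw` it gives `‖w‖⁴ ≤ τ² ‖y‖² ‖w‖²`, contrary to
  -- `hstrict`.
  have hcs : (w ⬝ᵥ w) ^ 2 ≤ (y ⬝ᵥ y) * ((G *ᵥ w) ⬝ᵥ (G *ᵥ w)) := by
    have h1 : w ⬝ᵥ w = y ⬝ᵥ (G *ᵥ w) := by
      rw [hw, dotProduct_transpose_mulVec, Matrix.mulVec_mulVec]
    rw [h1]
    simpa [dotProduct, sq] using Finset.sum_mul_sq_le_sq_mul_sq Finset.univ y (G *ᵥ w)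
  have hy0 : 0 ≤ y ⬝ᵥ y := by rw [dotProduct_self_eq_norm_sq]; positivity
  have hw0 : 0 < w ⬝ᵥ w := lt_of_le_of_lt (by positivity) hstrict
  have h3 : (y ⬝ᵥ y) * ((G *ᵥ w) ⬝ᵥ (G *ᵥ w)) ≤ (y ⬝ᵥ y) * (τ ^ 2 * (w ⬝ᵥ w)) :=
    mul_le_mul_of_nonneg_left hGw hy0
  nlinarith [mul_lt_mul_of_pos_right hstrict hw0]

end LeadingSubspace

/-! ### The squared Frobenius norm. -/

section Frobenius

variable {α β γ : Type*} [Fintype α] [Fintype β] [Fintype γ]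

/-- The squared Frobenius norm of a matrix. -/
def frobSq (B : Matrix α β ℝ) : ℝ := ∑ i, ∑ j, B i j ^ 2

lemma frobSq_nonneg (B : Matrix α β ℝ) : 0 ≤ frobSq B :=
  Finset.sum_nonneg fun _ _ => Finset.sum_nonneg fun _ _ => sq_nonneg _

lemma frobSq_eq_trace (B : Matrix α β ℝ) : frobSq B = (B * Bᵀ).trace := by
  simp [frobSq, Matrix.trace, Matrix.mul_apply, sq]

lemma frobSq_eq_trace' (B : Matrix α β ℝ) : frobSq B = (Bᵀ * B).trace := by
  rw [frobSq_eq_trace, Matrix.trace_mul_comm]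

lemma frobSq_mul_of_orthonormal [DecidableEq β] {V : Matrix α β ℝ} (hV : Vᵀ * V = 1)
    (B : Matrix β γ ℝ) : frobSq (V * B) = frobSq B := by
  rw [frobSq_eq_trace', frobSq_eq_trace', Matrix.transpose_mul, Matrix.mul_assoc,
    ← Matrix.mul_assoc Vᵀ, hV, Matrix.one_mul]

lemma eq_zero_of_frobSq_eq_zero {B : Matrix α β ℝ} (h : frobSq B = 0) : B = 0 := by
  ext i j
  have h1 := (Finset.sum_eq_zero_iff_of_nonneg
    fun i _ => Finset.sum_nonneg fun j _ => sq_nonneg (B i j)).1 h i (Finset.mem_univ _)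
  exact pow_eq_zero_iff two_ne_zero |>.1
    ((Finset.sum_eq_zero_iff_of_nonneg fun j _ => sq_nonneg (B i j)).1 h1 j (Finset.mem_univ _))

end Frobenius

/-! ### Gain of replacing a subspace by a leading one. -/

section Gap

variable {a s : ℕ} {c : Type} [Fintype c] [DecidableEq c]

/-- `G Gᵀ U Uᵀ = U D Uᵀ` is symmetric. -/
lemma IsLeadingLeft.proj_comm {G : Matrix (Fin a) c ℝ} {U : Matrix (Fin a) (Fin s) ℝ}
    (hU : IsLeadingLeft G U) : U * Uᵀ * (G * Gᵀ) = G * Gᵀ * (U * Uᵀ) := by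
  obtain ⟨-, e, hD⟩ := hU
  have h1 : (G * Gᵀ * (U * Uᵀ))ᵀ = G * Gᵀ * (U * Uᵀ) := by
    rw [← Matrix.mul_assoc, hD]
    simp [Matrix.mul_assoc]
  rw [← h1]
  simp [Matrix.mul_assoc]

lemma frobSq_compl_proj {U V : Matrix (Fin a) (Fin s) ℝ} (hU : Uᵀ * U = 1) (hV : Vᵀ * V = 1) :
    frobSq ((1 - U * Uᵀ) * V) = s - (Uᵀ * (V * Vᵀ) * U).trace := by
  have h : ((1 - U * Uᵀ) * V)ᵀ * ((1 - U * Uᵀ) * V) = 1 - Vᵀ * (U * (Uᵀ * V)) := by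
    have h2 : (1 - U * Uᵀ)ᵀ * (1 - U * Uᵀ) = 1 - U * Uᵀ := by
      simp only [Matrix.transpose_sub, Matrix.transpose_mul, Matrix.transpose_one,
        Matrix.transpose_transpose, sub_mul, mul_sub, proj_mul_proj hU, Matrix.one_mul,
        Matrix.mul_one, sub_self, sub_zero]
    rw [Matrix.transpose_mul, Matrix.mul_assoc, ← Matrix.mul_assoc _ _ V, h2, Matrix.sub_mul,
      Matrix.mul_sub, Matrix.one_mul, hV, Matrix.mul_assoc]
  rw [frobSq_eq_trace', h, Matrix.trace_sub, Matrix.trace_one, Fintype.card_fin,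
    Matrix.trace_mul_comm Vᵀ]
  congr 1
  rw [Matrix.mul_assoc, Matrix.mul_assoc, Matrix.trace_mul_comm U]

/-- On the complement of `U` the action of `Gᵀ` is at most `σ_{s+1}`, on the range of `U` at least
`σ_s`; the two subspaces have equal dimension, so each deviates from the other by the same amount.
-/
lemma IsLeadingLeft.frobSq_le {G : Matrix (Fin a) c ℝ} {U V : Matrix (Fin a) (Fin s) ℝ}
    (hU : IsLeadingLeft G U) (hV : Vᵀ * V = 1) {κ : ℝ}
    (hκ : sigma G (s + 1) ≤ κ * sigma G s) :
    frobSq (V * Vᵀ * (1 - U * Uᵀ) * G) ≤ κ ^ 2 * frobSq ((1 - V * Vᵀ) * (U * Uᵀ) * G) := by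
  have hUU := hU.1
  have hb : frobSq (V * Vᵀ * (1 - U * Uᵀ) * G) ≤
      sigma G (s + 1) ^ 2 * frobSq ((1 - U * Uᵀ) * V) := by
    have e1 : V * Vᵀ * (1 - U * Uᵀ) * G = V * (Vᵀ * (1 - U * Uᵀ) * G) := by
      simp only [Matrix.mul_assoc]
    rw [e1, frobSq_mul_of_orthonormal hV]
    have e2 : frobSq ((1 - U * Uᵀ) * V) = ∑ j, ((1 - U * Uᵀ) * V)ᵀ j ⬝ᵥ ((1 - U * Uᵀ) * V)ᵀ j := by
      rw [frobSq, Finset.sum_comm]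
      simp [dotProduct, sq]
    rw [e2, Finset.mul_sum, frobSq]
    refine Finset.sum_le_sum fun j _ => ?_
    have hx : Uᵀ *ᵥ (((1 - U * Uᵀ) * V)ᵀ j) = 0 := by
      have : Uᵀ * ((1 - U * Uᵀ) * V) = 0 := by
        rw [← Matrix.mul_assoc, Matrix.mul_sub, ← Matrix.mul_assoc, hUU, Matrix.one_mul, Matrix.mul_one,
          sub_self, Matrix.zero_mul]
      ext i
      exact congrFun (congrFun this i) j
    refine le_trans (le_of_eq ?_) (hU.bound_compl hx)
    have e3 : (Vᵀ * (1 - U * Uᵀ) * G : Matrix (Fin s) c ℝ) j = Gᵀ *ᵥ (((1 - U * Uᵀ) * V)ᵀ j) := by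
      have : Vᵀ * (1 - U * Uᵀ) * G = (Gᵀ * ((1 - U * Uᵀ) * V))ᵀ := by
        simp [Matrix.transpose_mul, Matrix.mul_assoc]
      rw [this]
      rfl
    rw [← e3]
    simp [dotProduct, sq]
  have ha : sigma G s ^ 2 * frobSq ((1 - V * Vᵀ) * U) ≤
      frobSq ((1 - V * Vᵀ) * (U * Uᵀ) * G) := by
    obtain ⟨-, e, hD⟩ := hU
    set E := (1 - V * Vᵀ) * U with hE
    set d : Fin s → ℝ := fun j => sigma G ((e j : ℕ) + 1) ^ 2 with hd
    have e1 : (1 - V * Vᵀ) * (U * Uᵀ) * G * ((1 - V * Vᵀ) * (U * Uᵀ) * G)ᵀ =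
        E * Matrix.diagonal d * Eᵀ := by
      have : (1 - V * Vᵀ) * (U * Uᵀ) * G = E * (Uᵀ * G) := by
        simp only [hE, Matrix.mul_assoc]
      rw [this, Matrix.transpose_mul]
      have : Uᵀ * G * (Uᵀ * G)ᵀ = Matrix.diagonal d := by
        rw [Matrix.transpose_mul, Matrix.transpose_transpose]
        calc Uᵀ * G * (Gᵀ * U) = Uᵀ * (G * Gᵀ * U) := by simp only [Matrix.mul_assoc]
          _ = Matrix.diagonal d := by rw [hD, ← Matrix.mul_assoc, hUU, Matrix.one_mul]
      rw [← this]
      simp only [Matrix.mul_assoc]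
    rw [frobSq_eq_trace ((1 - V * Vᵀ) * (U * Uᵀ) * G), e1, frobSq, Finset.mul_sum, Matrix.trace]
    refine Finset.sum_le_sum fun i _ => ?_
    rw [Matrix.diag_apply, Matrix.mul_apply, Finset.mul_sum]
    refine Finset.sum_le_sum fun j _ => ?_
    rw [Matrix.mul_diagonal, Matrix.transpose_apply]
    -- `(e j).2` reads as `e j + 1 ≤ s`, so the singular value attached to column `j` is at least
    -- `σ_s`.
    have hj : sigma G s ^ 2 ≤ d j :=
      pow_le_pow_left₀ (sigma_nonneg _ _) (sigma_anti G (e j).2) 2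
    nlinarith [mul_le_mul_of_nonneg_right hj (sq_nonneg (E i j))]
  -- Both sides equal `s - ‖Uᵀ V‖²`.
  have heq : frobSq ((1 - U * Uᵀ) * V) = frobSq ((1 - V * Vᵀ) * U) := by
    rw [frobSq_compl_proj hUU hV, frobSq_compl_proj hV hUU]
    congr 1
    rw [← Matrix.trace_transpose]
    have : (Uᵀ * (V * Vᵀ) * U)ᵀ = (Uᵀ * V) * (Vᵀ * U) := by
      simp [Matrix.transpose_mul, Matrix.mul_assoc]
    rw [this, Matrix.trace_mul_comm]
    simp only [Matrix.mul_assoc]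
  have hκ2 : sigma G (s + 1) ^ 2 ≤ κ ^ 2 * sigma G s ^ 2 := by
    rw [← mul_pow]
    exact pow_le_pow_left₀ (sigma_nonneg _ _) hκ 2
  calc _ ≤ _ := hb
    _ ≤ κ ^ 2 * sigma G s ^ 2 * frobSq ((1 - U * Uᵀ) * V) :=
      mul_le_mul_of_nonneg_right hκ2 (frobSq_nonneg _)
    _ = κ ^ 2 * (sigma G s ^ 2 * frobSq ((1 - V * Vᵀ) * U)) := by rw [heq]; ring
    _ ≤ _ := mul_le_mul_of_nonneg_left ha (sq_nonneg _)

/-- Both traces contain the common part `tr(Q P S)`, where `S = G Gᵀ`; since `P` commutes with `S`,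
what remains splits into the two squares without cross terms. -/
lemma IsLeadingLeft.trace_sub_trace {G : Matrix (Fin a) c ℝ} {U V : Matrix (Fin a) (Fin s) ℝ}
    (hU : IsLeadingLeft G U) (hV : Vᵀ * V = 1) :
    (U * Uᵀ * (G * Gᵀ)).trace - (V * Vᵀ * (G * Gᵀ)).trace =
      frobSq ((1 - V * Vᵀ) * (U * Uᵀ) * G) - frobSq (V * Vᵀ * (1 - U * Uᵀ) * G) := by
  have hc := hU.proj_comm
  have hPP := proj_mul_proj hU.1
  have hQQ := proj_mul_proj hV
  have hPt : (U * Uᵀ)ᵀ = U * Uᵀ := by simp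
  have hQt : (V * Vᵀ)ᵀ = V * Vᵀ := by simp
  rw [frobSq_eq_trace, frobSq_eq_trace]
  have e1 : (1 - V * Vᵀ) * (U * Uᵀ) * G * ((1 - V * Vᵀ) * (U * Uᵀ) * G)ᵀ =
      (1 - V * Vᵀ) * (U * Uᵀ * (G * Gᵀ) * (U * Uᵀ) * (1 - V * Vᵀ)) := by
    rw [Matrix.transpose_mul, Matrix.transpose_mul, Matrix.transpose_sub, Matrix.transpose_one,
      hPt, hQt]
    simp only [Matrix.mul_assoc]
  have e2 : V * Vᵀ * (1 - U * Uᵀ) * G * (V * Vᵀ * (1 - U * Uᵀ) * G)ᵀ =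
      V * Vᵀ * ((1 - U * Uᵀ) * (G * Gᵀ) * (1 - U * Uᵀ) * (V * Vᵀ)) := by
    rw [Matrix.transpose_mul, Matrix.transpose_mul, Matrix.transpose_sub, Matrix.transpose_one,
      hPt, hQt]
    simp only [Matrix.mul_assoc]
  rw [e1, e2, Matrix.trace_mul_comm (1 - V * Vᵀ), Matrix.trace_mul_comm (V * Vᵀ),
    Matrix.trace_mul_comm (V * Vᵀ)]
  generalize U * Uᵀ = P at *
  generalize V * Vᵀ = Q at *
  generalize G * Gᵀ = S at *
  have f1 : P * S * P = S * P := by rw [hc, Matrix.mul_assoc, hPP]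
  have f2 : (1 - P) * S * (1 - P) = S - S * P := by
    rw [sub_mul, sub_mul, mul_sub, mul_sub, f1, Matrix.one_mul, Matrix.mul_one, Matrix.mul_one, hc]
    abel
  have f3 : (1 - Q) * (1 - Q) = 1 - Q := by
    rw [sub_mul, mul_sub, mul_sub, hQQ, Matrix.one_mul, Matrix.mul_one, Matrix.one_mul]
    abel
  rw [f1, f2, Matrix.mul_assoc (S * P), f3, Matrix.mul_assoc (S - S * P), hQQ, sub_mul, mul_sub,
    Matrix.mul_one, Matrix.trace_sub, Matrix.trace_sub, hc]
  ring

end Gap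

/-! ### Mixed factor families and masks. -/

/-- The modes before `j` use the factors of `C`, the others those of `B`. -/
def hybrid (B C : MatFamily m r) (j : ℕ) : MatFamily m r :=
  fun i => if (i : ℕ) < j then C i else B i

lemma hybrid_self (B C : MatFamily m r) (n : Fin N) : hybrid B C n n = B n := by
  simp [hybrid]

lemma hybrid_succ_self (B C : MatFamily m r) (n : Fin N) : hybrid B C (n + 1) n = C n := by
  simp [hybrid]

lemma hybrid_succ_of_ne (B C : MatFamily m r) {n l : Fin N} (h : l ≠ n) :
    hybrid B C (n + 1) l = hybrid B C n l := by
  have : (l : ℕ) ≠ n := fun h' => h (Fin.ext h')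
  simp only [hybrid]
  congr 1
  simp only [eq_iff_iff]
  omega

lemma hybrid_zero (B C : MatFamily m r) : hybrid B C 0 = B := by
  ext i : 1
  simp [hybrid]

lemma hybrid_last (B C : MatFamily m r) : hybrid B C N = C := by
  ext i : 1
  simp [hybrid]

lemma gMat_hybrid_succ (X : Tensor m) (B C : MatFamily m r) (n : Fin N) :
    gMat n X (hybrid B C (n + 1)) = gMat n X (hybrid B C n) :=
  gMat_congr fun _ hl => hybrid_succ_of_ne B C hl

lemma tinner_compress_hybrid_succ (X : Tensor m) (B C : MatFamily m r) (n : Fin N) :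
    tinner X (compress X (hybrid B C (n + 1))) - tinner X (compress X (hybrid B C n)) =
      (C n * (C n)ᵀ * (gMat n X (hybrid B C n) * (gMat n X (hybrid B C n))ᵀ)).trace -
      (B n * (B n)ᵀ * (gMat n X (hybrid B C n) * (gMat n X (hybrid B C n))ᵀ)).trace := by
  rw [tinner_self_compress n, tinner_self_compress n, gMat_hybrid_succ, hybrid_succ_self,
    hybrid_self]

lemma mask_apply_mem {S : Set (∀ l, Fin (m l))} {i : ∀ l, Fin (m l)} (h : i ∈ S) (X : Tensor m) :
    mask S X i = X i := Set.indicator_of_mem h X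

lemma mask_apply_notMem {S : Set (∀ l, Fin (m l))} {i : ∀ l, Fin (m l)} (h : i ∉ S)
    (X : Tensor m) : mask S X i = 0 := Set.indicator_of_notMem h X

lemma mask_add_mask_compl (S : Set (∀ l, Fin (m l))) (X : Tensor m) :
    mask S X + mask Sᶜ X = X := Set.indicator_self_add_compl S X

lemma continuous_mask (S : Set (∀ l, Fin (m l))) : Continuous (mask S : Tensor m → Tensor m) := by
  refine continuous_pi fun i => ?_
  by_cases h : i ∈ S
  · simpa only [mask_apply_mem h] using continuous_apply i
  · simpa only [mask_apply_notMem h] using continuous_const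

/-- The update of the missing entries decreases the objective by at least half the squared
length of the step. -/
lemma objective_fill_le {Ω : Set (∀ l, Fin (m l))} {A : MatFamily m r}
    (hA : ∀ n, (A n)ᵀ * A n = 1) {X X' : Tensor m} (h1 : mask Ω X' = mask Ω X)
    (h2 : mask Ωᶜ X' = mask Ωᶜ (compress X A)) :
    objective A X' + 1 / 2 * tinner (X' - X) (X' - X) ≤ objective A X := by
  -- The step is the residual `compress X A - X` off `Ω` and zero on `Ω`, hence orthogonal to the
  -- rest of the residual.
  have hDE : tinner (X' - X) (compress X A - X) = tinner (X' - X) (X' - X) := by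
    refine Finset.sum_congr rfl fun i _ => ?_
    by_cases hi : i ∈ Ω
    · have := congrFun h1 i
      rw [mask_apply_mem hi, mask_apply_mem hi] at this
      simp [this]
    · have := congrFun h2 i
      rw [mask_apply_mem (S := Ωᶜ) hi, mask_apply_mem (S := Ωᶜ) hi] at this
      simp [this]
  have hPD : compress X' A = compress X A + compress (X' - X) A := by
    rw [compress_sub]; abel
  -- The new residual is orthogonal to the range of the compression, so `hdec` is an orthogonal
  -- splitting; computing its norm in two ways gives the decrease.
  have horth : tinner (compress X' A - X') (compress (X' - X) A) = 0 := by
    rw [← tinner_compress, compress_sub, compress_compress _ hA, sub_self]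
    simp [tinner]
  have hdec : compress X A - X - (X' - X) = compress X' A - X' - compress (X' - X) A := by
    rw [hPD]; abel
  have hn : tinner (compress X A - X - (X' - X)) (compress X A - X - (X' - X)) =
      tinner (compress X A - X) (compress X A - X) - tinner (X' - X) (X' - X) := by
    rw [tinner_sub_left _ (X' - X), tinner_sub_right (X' - X) _ (X' - X), hDE,
      tinner_sub_right _ _ (X' - X), tinner_comm _ (X' - X), hDE]
    ring
  have hn' : tinner (compress X A - X - (X' - X)) (compress X A - X - (X' - X)) =
      tinner (compress X' A - X') (compress X' A - X') +
        tinner (compress (X' - X) A) (compress (X' - X) A) := by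
    rw [hdec, tinner_sub_left _ (compress (X' - X) A), tinner_sub_right _ _ (compress (X' - X) A),
      tinner_sub_right _ _ (compress (X' - X) A), horth, tinner_comm (compress (X' - X) A), horth]
    ring
  have := tinner_self_nonneg (compress (X' - X) A)
  simp only [objective]
  linarith

/-! ### Descent along the iteration. -/

namespace IsIHOOI

variable {Ω : Set (∀ l, Fin (m l))} {M : Tensor m} {A : ℕ → MatFamily m r} {X : ℕ → Tensor m}

lemma orthonormal (h : IsIHOOI Ω M A X) : ∀ k n, (A k n)ᵀ * A k n = 1
  | 0, n => h.init_orth n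
  | k + 1, n => (h.factor_step k n).1

lemma mask_eq (h : IsIHOOI Ω M A X) (k : ℕ) : mask Ω (X k) = mask Ω M := by
  induction k with
  | zero => exact h.init_obs
  | succ k ih => rw [h.obs_step, ih]

lemma frobSq_le_frobSq (h : IsIHOOI Ω M A X) (k : ℕ) (n : Fin N) :
    frobSq (A k n * (A k n)ᵀ * (1 - A (k + 1) n * (A (k + 1) n)ᵀ) * gIter A X k n) ≤
      frobSq ((1 - A k n * (A k n)ᵀ) * (A (k + 1) n * (A (k + 1) n)ᵀ) * gIter A X k n) := by
  have := (h.factor_step k n).frobSq_le (h.orthonormal k n) (κ := 1)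
    (by rw [one_mul]; exact sigma_anti _ (Nat.le_succ _))
  simpa using this

lemma tinner_compress_hybrid_sub (h : IsIHOOI Ω M A X) (k : ℕ) (n : Fin N) :
    tinner (X k) (compress (X k) (hybrid (A k) (A (k + 1)) (n + 1))) -
      tinner (X k) (compress (X k) (hybrid (A k) (A (k + 1)) n)) =
    frobSq ((1 - A k n * (A k n)ᵀ) * (A (k + 1) n * (A (k + 1) n)ᵀ) * gIter A X k n) -
      frobSq (A k n * (A k n)ᵀ * (1 - A (k + 1) n * (A (k + 1) n)ᵀ) * gIter A X k n) := by
  rw [tinner_compress_hybrid_succ]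
  exact (h.factor_step k n).trace_sub_trace (h.orthonormal k n)

/-- The gains of the single modes telescope through the mixed families from `A k` to `A (k + 1)`
with `X k` fixed; the fill step adds its own decrease. -/
lemma objective_descent (h : IsIHOOI Ω M A X) (k : ℕ) :
    1 / 2 * ∑ n,
      (frobSq ((1 - A k n * (A k n)ᵀ) * (A (k + 1) n * (A (k + 1) n)ᵀ) * gIter A X k n) -
      frobSq (A k n * (A k n)ᵀ * (1 - A (k + 1) n * (A (k + 1) n)ᵀ) * gIter A X k n)) +
      1 / 2 * tinner (X (k + 1) - X k) (X (k + 1) - X k) ≤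
    objective (A k) (X k) - objective (A (k + 1)) (X (k + 1)) := by
  have h1 := objective_fill_le (h.orthonormal (k + 1)) (h.obs_step k) (h.fill_step k)
  have h2 : ∑ n : Fin N,
      (frobSq ((1 - A k n * (A k n)ᵀ) * (A (k + 1) n * (A (k + 1) n)ᵀ) * gIter A X k n) -
      frobSq (A k n * (A k n)ᵀ * (1 - A (k + 1) n * (A (k + 1) n)ᵀ) * gIter A X k n)) =
      tinner (X k) (compress (X k) (A (k + 1))) - tinner (X k) (compress (X k) (A k)) := by
    simp only [← h.tinner_compress_hybrid_sub]
    rw [Fin.sum_univ_eq_sum_range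
      (fun n => tinner (X k) (compress (X k) (hybrid (A k) (A (k + 1)) (n + 1))) -
        tinner (X k) (compress (X k) (hybrid (A k) (A (k + 1)) n))) N,
      Finset.sum_range_sub
        (fun n => tinner (X k) (compress (X k) (hybrid (A k) (A (k + 1)) n))),
      hybrid_zero, hybrid_last]
  rw [h2]
  rw [objective_eq _ (h.orthonormal (k + 1))] at h1 ⊢
  rw [objective_eq _ (h.orthonormal (k + 1))] at h1
  rw [objective_eq _ (h.orthonormal k)]
  linarith

lemma gain_nonneg (h : IsIHOOI Ω M A X) (k : ℕ) :
    ∀ n ∈ (Finset.univ : Finset (Fin N)),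
      0 ≤ frobSq ((1 - A k n * (A k n)ᵀ) * (A (k + 1) n * (A (k + 1) n)ᵀ) * gIter A X k n) -
        frobSq (A k n * (A k n)ᵀ * (1 - A (k + 1) n * (A (k + 1) n)ᵀ) * gIter A X k n) :=
  fun n _ => sub_nonneg.2 (h.frobSq_le_frobSq k n)

lemma tendsto_objective_sub (h : IsIHOOI Ω M A X) :
    Tendsto (fun k => objective (A k) (X k) - objective (A (k + 1)) (X (k + 1))) atTop (𝓝 0) := by
  have hanti : Antitone fun k => objective (A k) (X k) := antitone_nat_of_succ_le fun k => by
    have h1 := h.objective_descent k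
    have h2 := Finset.sum_nonneg (h.gain_nonneg k)
    have h3 := tinner_self_nonneg (X (k + 1) - X k)
    linarith
  have hbdd : BddBelow (Set.range fun k => objective (A k) (X k)) := by
    refine ⟨0, ?_⟩
    rintro _ ⟨k, rfl⟩
    exact mul_nonneg (by norm_num) (tinner_self_nonneg _)
  have hlim := tendsto_atTop_ciInf hanti hbdd
  simpa using hlim.sub (hlim.comp (tendsto_add_atTop_nat 1))

lemma tendsto_step (h : IsIHOOI Ω M A X) :
    Tendsto (fun k => tinner (X (k + 1) - X k) (X (k + 1) - X k)) atTop (𝓝 0) := by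
  refine squeeze_zero (fun k => tinner_self_nonneg _) (fun k => ?_)
    (by simpa using h.tendsto_objective_sub.const_mul 2)
  have h1 := h.objective_descent k
  have h2 := Finset.sum_nonneg (h.gain_nonneg k)
  linarith

/-- If the gap ratio in mode `n` has upper limit below one, then the spaces spanned by
consecutive mode-`n` factors agree asymptotically on the range of `G_n^k`. -/
lemma tendsto_frobSq (h : IsIHOOI Ω M A X) (n : Fin N)
    (hgap : limsup (fun k => sigma (gIter A X k n) (r n + 1) / sigma (gIter A X k n) (r n))
      atTop < 1) :
    Tendsto (fun k => frobSq
      ((1 - A k n * (A k n)ᵀ) * (A (k + 1) n * (A (k + 1) n)ᵀ) * gIter A X k n)) atTop (𝓝 0) := by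
  obtain ⟨κ, hκ1, hκ2⟩ := exists_between hgap
  have hbdd : IsBoundedUnder (· ≤ ·) atTop
      fun k => sigma (gIter A X k n) (r n + 1) / sigma (gIter A X k n) (r n) :=
    isBoundedUnder_of ⟨1, fun k =>
      div_le_one_of_le₀ (sigma_anti _ (Nat.le_succ _)) (sigma_nonneg _ _)⟩
  have hev := eventually_lt_of_limsup_lt hκ1 hbdd
  have hκ0 : 0 ≤ κ := by
    obtain ⟨k, hk⟩ := hev.exists
    exact (div_nonneg (sigma_nonneg _ _) (sigma_nonneg _ _)).trans hk.le
  have hpos : 0 < 1 - κ ^ 2 := by nlinarith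
  refine squeeze_zero' (Eventually.of_forall fun k => frobSq_nonneg _) (hev.mono fun k hk => ?_)
    -- The gain is at least `1 - κ²` times the first square, and half of it is bounded by the
    -- decrease of the objective.
    (by simpa using h.tendsto_objective_sub.const_mul (2 / (1 - κ ^ 2)))
  have hσ : sigma (gIter A X k n) (r n + 1) ≤ κ * sigma (gIter A X k n) (r n) := by
    -- A zero denominator makes the ratio `0` and says nothing by itself; then `σ_{r+1} ≤ σ_r = 0`
    -- gives the bound.
    rcases (sigma_nonneg (gIter A X k n) (r n)).eq_or_lt with h0 | h0
    · rw [← h0, mul_zero, h0]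
      exact sigma_anti _ (Nat.le_succ _)
    · exact ((div_lt_iff₀ h0).1 hk).le
  have h1 := (h.factor_step k n).frobSq_le (h.orthonormal k n) hσ
  have h2 := h.objective_descent k
  have h3 := Finset.single_le_sum (h.gain_nonneg k) (Finset.mem_univ n)
  have h4 := tinner_self_nonneg (X (k + 1) - X k)
  rw [div_mul_eq_mul_div, le_div_iff₀ hpos]
  linarith

lemma tendsto_frobSq' (h : IsIHOOI Ω M A X) (n : Fin N)
    (hgap : limsup (fun k => sigma (gIter A X k n) (r n + 1) / sigma (gIter A X k n) (r n))
      atTop < 1) :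
    Tendsto (fun k => frobSq
      (A k n * (A k n)ᵀ * (1 - A (k + 1) n * (A (k + 1) n)ᵀ) * gIter A X k n)) atTop (𝓝 0) :=
  squeeze_zero (fun _ => frobSq_nonneg _) (fun k => h.frobSq_le_frobSq k n)
    (h.tendsto_frobSq n hgap)

end IsIHOOI

/-! ### Continuity -/

lemma continuous_matricize (n : Fin N) :
    Continuous (matricize n : Tensor m → Matrix (Fin (m n)) (ColIdx m n) ℝ) :=
  continuous_matrix fun _ _ => continuous_apply _

lemma continuous_kron (n : Fin N) :
    Continuous (kron n : MatFamily m r → Matrix (ColIdx m n) (ColIdx r n) ℝ) :=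
  continuous_matrix fun j i => by
    simp only [kron, Matrix.of_apply]
    refine continuous_finsetProd _ fun l _ => ?_
    have hl : Continuous fun B : MatFamily m r => B l := continuous_apply l.1
    exact hl.matrix_elem (j l) (i l)

lemma continuous_hybrid (j : ℕ) :
    Continuous fun z : MatFamily m r × MatFamily m r => hybrid z.1 z.2 j := by
  refine continuous_pi fun i => ?_
  by_cases h : (i : ℕ) < j
  · simp only [hybrid, h, if_true]
    exact (continuous_apply i).comp continuous_snd
  · simp only [hybrid, h, if_false]
    exact (continuous_apply i).comp continuous_fst

lemma continuous_frobSq {α β : Type*} [Fintype α] [Fintype β] :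
    Continuous (frobSq : Matrix α β ℝ → ℝ) :=
  continuous_finsetSum _ fun i _ => continuous_finsetSum _ fun j _ =>
    (continuous_id.matrix_elem i j).pow 2

/-! ### Stationarity at limit points -/

/-- The multipliers of the orthonormality constraints. -/
def factorMultiplier (A : MatFamily m r) (X : Tensor m) : MatFamily r r :=
  fun n => (A n)ᵀ * (gMat n X A * (gMat n X A)ᵀ) * A n

/-- The multiplier of the constraint on the observed entries. -/
def obsMultiplier (A : MatFamily m r) (X : Tensor m) : Tensor m := compress X A - X

lemma isSymm_factorMultiplier (A : MatFamily m r) (X : Tensor m) (n : Fin N) :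
    (factorMultiplier A X n).IsSymm := by
  simp [Matrix.IsSymm, factorMultiplier, Matrix.mul_assoc]

/-- A feasible point is stationary if the range of each `A_n` is invariant under `G_n G_nᵀ` and the
missing entries agree with the compression. -/
structure IsStationary (Ω : Set (∀ l, Fin (m l))) (M : Tensor m) (A : MatFamily m r)
    (X : Tensor m) : Prop where
  orth : ∀ n, (A n)ᵀ * A n = 1
  obs : mask Ω X = mask Ω M
  factor : ∀ n, (1 - A n * (A n)ᵀ) * (gMat n X A * (gMat n X A)ᵀ) * A n = 0
  fill : mask Ωᶜ X = mask Ωᶜ (compress X A)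

lemma IsStationary.add_mask_obsMultiplier {Ω : Set (∀ l, Fin (m l))} {M : Tensor m}
    {A : MatFamily m r} {X : Tensor m} (h : IsStationary Ω M A X) :
    X - compress X A + mask Ω (obsMultiplier A X) = 0 := by
  ext i
  by_cases hi : i ∈ Ω
  · simp [mask_apply_mem hi, obsMultiplier]
  · have := congrFun h.fill i
    rw [mask_apply_mem (S := Ωᶜ) hi, mask_apply_mem (S := Ωᶜ) hi] at this
    simp [mask_apply_notMem hi, this]

lemma IsStationary.kktResidual_eq_zero {Ω : Set (∀ l, Fin (m l))} {M : Tensor m}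
    {A : MatFamily m r} {X : Tensor m} (h : IsStationary Ω M A X) :
    kktResidual Ω M (A, X, factorMultiplier A X, obsMultiplier A X) = 0 := by
  refine Prod.ext ?_ (Prod.ext ?_ (Prod.ext ?_ ?_))
  · ext n : 1
    refine Eq.trans ?_ (h.factor n)
    simp only [kktResidual, factorMultiplier, Matrix.sub_mul, Matrix.one_mul, Matrix.mul_assoc]
  · exact h.add_mask_obsMultiplier
  · ext n : 1
    exact sub_eq_zero.2 (h.orth n)
  · exact sub_eq_zero.2 h.obs

/-- Here `B` and `C` are limits of `A^k` and `A^{k+1}`. All mixed families compress `X` to the same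
tensor, so `G Gᵀ` times the projector of `B_n` may be computed with `C_n` and the mixed `G`, where
`hc` and `h1` apply. -/
lemma isStationary_of_hybrid {Ω : Set (∀ l, Fin (m l))} {M : Tensor m} {B C : MatFamily m r}
    {X : Tensor m} (hB : ∀ n, (B n)ᵀ * B n = 1) (hobs : mask Ω X = mask Ω M)
    (hfill : mask Ωᶜ X = mask Ωᶜ (compress X C))
    (h1 : ∀ n : Fin N, (1 - B n * (B n)ᵀ) * (C n * (C n)ᵀ) * gMat n X (hybrid B C n) = 0)
    (h2 : ∀ n : Fin N, B n * (B n)ᵀ * (1 - C n * (C n)ᵀ) * gMat n X (hybrid B C n) = 0)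
    (hc : ∀ n : Fin N,
      C n * (C n)ᵀ * (gMat n X (hybrid B C n) * (gMat n X (hybrid B C n))ᵀ) =
      gMat n X (hybrid B C n) * (gMat n X (hybrid B C n))ᵀ * (C n * (C n)ᵀ)) :
    IsStationary Ω M B X := by
  have hstep : ∀ n : Fin N,
      compress X (hybrid B C (n + 1)) = compress X (hybrid B C n) := by
    intro n
    apply matricize_injective n
    rw [matricize_compress, matricize_compress, gMat_hybrid_succ, hybrid_succ_self, hybrid_self,
      kron_congr fun _ hl => hybrid_succ_of_ne B C hl, ← Matrix.mul_assoc, ← Matrix.mul_assoc]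
    congr 1
    -- `e1` becomes `P G = Q P G` and `e2` becomes `Q G = Q P G`, whence `P G = Q G`.
    have e1 := h1 n
    have e2 := h2 n
    rw [Matrix.sub_mul, Matrix.one_mul, Matrix.sub_mul, sub_eq_zero] at e1
    rw [Matrix.mul_sub, Matrix.mul_one, Matrix.sub_mul, sub_eq_zero] at e2
    rw [e1, e2]
  have hall : ∀ j, j ≤ N → compress X (hybrid B C j) = compress X B := by
    intro j
    induction j with
    | zero => intro _; rw [hybrid_zero]
    | succ j ih => intro hj; rw [hstep ⟨j, hj⟩, ih (Nat.le_of_succ_le hj)]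
  refine ⟨hB, hobs, fun n => ?_, ?_⟩
  · have e1 := matricize_mul_matricize_compress n X B
    rw [← hall (n + 1) n.2, matricize_mul_matricize_compress, gMat_hybrid_succ, hybrid_succ_self,
      ← hc] at e1
    have e2 : (1 - B n * (B n)ᵀ) * (gMat n X B * (gMat n X B)ᵀ) * B n =
        (1 - B n * (B n)ᵀ) * (gMat n X B * (gMat n X B)ᵀ * (B n * (B n)ᵀ)) * B n := by
      simp only [Matrix.mul_assoc, hB n, Matrix.mul_one]
    rw [e2, ← e1, ← Matrix.mul_assoc, ← Matrix.mul_assoc, h1 n, Matrix.zero_mul, Matrix.zero_mul]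
  · have := hall N le_rfl
    rw [hybrid_last] at this
    rw [hfill, this]

/-- A compact set that contains all orthonormal factor families. -/
lemma exists_isCompact_orthonormal (m r : Fin N → ℕ) :
    ∃ K : Set (MatFamily m r), IsCompact K ∧
      ∀ A : MatFamily m r, (∀ n, (A n)ᵀ * A n = 1) → A ∈ K := by
  refine ⟨Set.univ.pi fun n => (Set.univ.pi fun _ => Set.univ.pi fun _ => Set.Icc (-1 : ℝ) 1 :
    Set (Fin (m n) → Fin (r n) → ℝ)), ?_, ?_⟩
  · exact isCompact_univ_pi fun n => (isCompact_univ_pi fun _ => isCompact_univ_pi fun _ =>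
      isCompact_Icc : IsCompact (_ : Set (Fin (m n) → Fin (r n) → ℝ)))
  · intro A hA n _ i _ j _
    have h1 : ∑ i, A n i j * A n i j = 1 := by
      simpa [Matrix.mul_apply] using congrFun (congrFun (hA n) j) j
    have h2 := Finset.single_le_sum (f := fun i => A n i j * A n i j)
      (fun i _ => mul_self_nonneg _) (Finset.mem_univ i)
    refine abs_le.1 ((sq_le_one_iff_abs_le_one _).1 ?_)
    rw [sq]
    exact h2.trans h1.le

lemma tendsto_zero_of_tinner {ι : Type*} {l : Filter ι} {D : ι → Tensor m}
    (h : Tendsto (fun k => tinner (D k) (D k)) l (𝓝 0)) : Tendsto D l (𝓝 0) := by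
  refine tendsto_pi_nhds.2 fun i => ?_
  have h1 : Tendsto (fun k => D k i ^ 2) l (𝓝 0) := by
    refine squeeze_zero (fun k => sq_nonneg _) (fun k => ?_) h
    rw [sq]
    exact Finset.single_le_sum (f := fun i => D k i * D k i) (fun i _ => mul_self_nonneg _)
      (Finset.mem_univ i)
  have h2 := h1.sqrt
  simp only [Real.sqrt_sq_eq_abs, Real.sqrt_zero] at h2
  exact (tendsto_zero_iff_abs_tendsto_zero _).2 h2

lemma tendsto_matrix_mul {ι α β γ : Type*} [Fintype β] {l : Filter ι} {F : ι → Matrix α β ℝ}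
    {H : ι → Matrix β γ ℝ} {F₀ : Matrix α β ℝ} {H₀ : Matrix β γ ℝ} (hF : Tendsto F l (𝓝 F₀))
    (hH : Tendsto H l (𝓝 H₀)) : Tendsto (fun k => F k * H k) l (𝓝 (F₀ * H₀)) :=
  ((continuous_fst.matrix_mul continuous_snd).tendsto (F₀, H₀)).comp (hF.prodMk_nhds hH)

lemma tendsto_matrix_transpose {ι α β : Type*} {l : Filter ι} {F : ι → Matrix α β ℝ}
    {F₀ : Matrix α β ℝ} (hF : Tendsto F l (𝓝 F₀)) : Tendsto (fun k => (F k)ᵀ) l (𝓝 F₀ᵀ) :=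
  (continuous_id.matrix_transpose.tendsto F₀).comp hF

lemma tendsto_hybrid {ι : Type*} {l : Filter ι} {b c : ι → MatFamily m r} {B C : MatFamily m r}
    (hb : Tendsto b l (𝓝 B)) (hc : Tendsto c l (𝓝 C)) (j : ℕ) :
    Tendsto (fun k => hybrid (b k) (c k) j) l (𝓝 (hybrid B C j)) :=
  ((continuous_hybrid (m := m) (r := r) j).tendsto (B, C)).comp (hb.prodMk_nhds hc)

lemma tendsto_gMat {ι : Type*} {l : Filter ι} {b : ι → MatFamily m r} {B : MatFamily m r}
    {y : ι → Tensor m} {Y : Tensor m} (hb : Tendsto b l (𝓝 B)) (hy : Tendsto y l (𝓝 Y))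
    (n : Fin N) : Tendsto (fun k => gMat n (y k) (b k)) l (𝓝 (gMat n Y B)) := by
  simp only [gMat_eq]
  exact tendsto_matrix_mul (((continuous_matricize n).tendsto Y).comp hy)
    (((continuous_kron n).tendsto B).comp hb)

lemma tendsto_gIter {A : ℕ → MatFamily m r} {X : ℕ → Tensor m} {l : Filter ℕ}
    {B C : MatFamily m r} {Y : Tensor m} (hA : Tendsto A l (𝓝 B))
    (hA' : Tendsto (fun k => A (k + 1)) l (𝓝 C)) (hX : Tendsto X l (𝓝 Y)) (n : Fin N) :
    Tendsto (fun k => gIter A X k n) l (𝓝 (gMat n Y (hybrid B C n))) := by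
  have h1 : Tendsto (fun k => hybrid (A k) (A (k + 1)) n) l (𝓝 (hybrid B C n)) :=
    tendsto_hybrid hA hA' n
  have h2 : Tendsto (fun k => gMat n (X k) (hybrid (A k) (A (k + 1)) n)) l
    (𝓝 (gMat n Y (hybrid B C n))) := tendsto_gMat h1 hX n
  exact h2

lemma tendsto_compress {ι : Type*} {l : Filter ι} {b : ι → MatFamily m r} {B : MatFamily m r}
    {y : ι → Tensor m} {Y : Tensor m} (hb : Tendsto b l (𝓝 B)) (hy : Tendsto y l (𝓝 Y)) :
    Tendsto (fun k => compress (y k) (b k)) l (𝓝 (compress Y B)) := by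
  refine tendsto_pi_nhds.2 fun j => tendsto_finsetSum _ fun i _ => ?_
  refine (tendsto_finsetProd _ fun n _ => ?_).mul (tendsto_pi_nhds.1 hy i)
  have hn := tendsto_pi_nhds.1 hb n
  exact tendsto_pi_nhds.1 (tendsto_pi_nhds.1
    (tendsto_matrix_mul hn (tendsto_matrix_transpose hn)) (j n)) (i n)

/-- Limit points of the iteration are stationary. -/
lemma IsIHOOI.isStationary {Ω : Set (∀ l, Fin (m l))} {M : Tensor m} {A : ℕ → MatFamily m r}
    {X : ℕ → Tensor m} (h : IsIHOOI Ω M A X)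
    (hgap : ∀ n, limsup (fun k => sigma (gIter A X k n) (r n + 1) / sigma (gIter A X k n) (r n))
      atTop < 1)
    {B : MatFamily m r} {Y : Tensor m} (hBY : MapClusterPt (B, Y) atTop fun k => (A k, X k)) :
    IsStationary Ω M B Y := by
  obtain ⟨g, hg, hlim⟩ := mapClusterPt_iff_ultrafilter.1 hBY
  have hA : Tendsto A g (𝓝 B) := (continuous_fst.tendsto _).comp hlim
  have hX : Tendsto X g (𝓝 Y) := (continuous_snd.tendsto _).comp hlim
  obtain ⟨K, hK, hKA⟩ := exists_isCompact_orthonormal m r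
  -- The shifted factors converge along `g` to some `C`, possibly different from `B`; the shifted
  -- tensors have the same limit `Y`, because the steps vanish.
  obtain ⟨C, -, hC⟩ := hK.ultrafilter_le_nhds (g.map fun k => A (k + 1))
    (le_principal_iff.2 (Ultrafilter.mem_map.2
      (univ_mem' fun k => hKA _ (h.orthonormal (k + 1)))))
  have hA' : Tendsto (fun k => A (k + 1)) g (𝓝 C) := hC
  have hX' : Tendsto (fun k => X (k + 1)) g (𝓝 Y) := by
    have := (tendsto_zero_of_tinner (h.tendsto_step.mono_left hg)).add hX
    simpa using this
  have hAn : ∀ n, Tendsto (fun k => A k n) g (𝓝 (B n)) := fun n => tendsto_pi_nhds.1 hA n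
  have hAn' : ∀ n, Tendsto (fun k => A (k + 1) n) g (𝓝 (C n)) := fun n => tendsto_pi_nhds.1 hA' n
  have hP : ∀ n, Tendsto (fun k => A k n * (A k n)ᵀ) g (𝓝 (B n * (B n)ᵀ)) := fun n =>
    tendsto_matrix_mul (hAn n) (tendsto_matrix_transpose (hAn n))
  have hP' : ∀ n, Tendsto (fun k => A (k + 1) n * (A (k + 1) n)ᵀ) g (𝓝 (C n * (C n)ᵀ)) := fun n =>
    tendsto_matrix_mul (hAn' n) (tendsto_matrix_transpose (hAn' n))
  have hG : ∀ n : Fin N, Tendsto (fun k => gIter A X k n) g (𝓝 (gMat n Y (hybrid B C n))) :=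
    fun n => tendsto_gIter hA hA' hX n
  have hS : ∀ n : Fin N, Tendsto (fun k => gIter A X k n * (gIter A X k n)ᵀ) g
      (𝓝 (gMat n Y (hybrid B C n) * (gMat n Y (hybrid B C n))ᵀ)) := fun n =>
    tendsto_matrix_mul (hG n) (tendsto_matrix_transpose (hG n))
  have orth : ∀ n, (B n)ᵀ * B n = 1 := fun n =>
    tendsto_nhds_unique (tendsto_matrix_mul (tendsto_matrix_transpose (hAn n)) (hAn n))
      (tendsto_const_nhds.congr fun k => (h.orthonormal k n).symm)
  have obs : mask Ω Y = mask Ω M :=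
    tendsto_nhds_unique (((continuous_mask Ω).tendsto _).comp hX)
      (tendsto_const_nhds.congr fun k => (h.mask_eq k).symm)
  have fill : mask Ωᶜ Y = mask Ωᶜ (compress Y C) :=
    tendsto_nhds_unique
      ((((continuous_mask Ωᶜ).tendsto _).comp hX').congr fun k => h.fill_step k)
      (((continuous_mask Ωᶜ).tendsto _).comp (tendsto_compress hA' hX))
  have h1 : ∀ n : Fin N,
      (1 - B n * (B n)ᵀ) * (C n * (C n)ᵀ) * gMat n Y (hybrid B C n) = 0 := fun n => by
    have hT := tendsto_matrix_mul
      (tendsto_matrix_mul ((tendsto_const_nhds (x := 1)).sub (hP n)) (hP' n)) (hG n)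
    exact eq_zero_of_frobSq_eq_zero (tendsto_nhds_unique ((continuous_frobSq.tendsto _).comp hT)
      ((h.tendsto_frobSq n (hgap n)).mono_left hg))
  have h2 : ∀ n : Fin N,
      B n * (B n)ᵀ * (1 - C n * (C n)ᵀ) * gMat n Y (hybrid B C n) = 0 := fun n => by
    have hT := tendsto_matrix_mul
      (tendsto_matrix_mul (hP n) ((tendsto_const_nhds (x := 1)).sub (hP' n))) (hG n)
    exact eq_zero_of_frobSq_eq_zero (tendsto_nhds_unique ((continuous_frobSq.tendsto _).comp hT)
      ((h.tendsto_frobSq' n (hgap n)).mono_left hg))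
  exact isStationary_of_hybrid orth obs fill h1 h2 fun n =>
    tendsto_nhds_unique (tendsto_matrix_mul (hP' n) (hS n))
      ((tendsto_matrix_mul (hS n) (hP' n)).congr fun k => ((h.factor_step k n).proj_comm).symm)

/-! ### The gradient of the Lagrangian -/

lemma hasDerivAt_quadratic (a b c : ℝ) :
    HasDerivAt (fun t : ℝ => a + t * b + t ^ 2 * c) b 0 := by
  refine ((((hasDerivAt_id' (0 : ℝ)).mul_const b).const_add a).fun_add
    ((hasDerivAt_pow 2 (0 : ℝ)).mul_const c)).congr_deriv ?_
  simp

lemma hasDerivAt_frobSq {α β : Type*} [Fintype α] [Fintype β] (E₀ E₁ E₂ : Matrix α β ℝ) :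
    HasDerivAt (fun t : ℝ => frobSq (E₀ + t • E₁ + t ^ 2 • E₂)) (2 * (E₀ * E₁ᵀ).trace) 0 := by
  have key : ∀ i j, HasDerivAt (fun t : ℝ => (E₀ + t • E₁ + t ^ 2 • E₂) i j ^ 2)
      (2 * (E₀ i j * E₁ i j)) 0 := by
    intro i j
    have h1 := (hasDerivAt_quadratic (E₀ i j) (E₁ i j) (E₂ i j)).fun_pow 2
    refine h1.congr_deriv ?_
    simp
    ring
  refine (HasDerivAt.fun_sum fun i (_ : i ∈ (Finset.univ : Finset α)) =>
    HasDerivAt.fun_sum fun j (_ : j ∈ (Finset.univ : Finset β)) => key i j).congr_deriv ?_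
  simp only [Matrix.trace, Matrix.diag_apply, Matrix.mul_apply, Matrix.transpose_apply,
    Finset.mul_sum]

lemma hasDerivAt_tinner (E₀ E₁ : Tensor m) :
    HasDerivAt (fun t : ℝ => tinner (E₀ + t • E₁) (E₀ + t • E₁)) (2 * tinner E₀ E₁) 0 := by
  have h : (fun t : ℝ => tinner (E₀ + t • E₁) (E₀ + t • E₁)) =
      fun t => tinner E₀ E₀ + t * (2 * tinner E₀ E₁) + t ^ 2 * tinner E₁ E₁ := by
    ext t
    simp only [tinner_add_left, tinner_add_right, tinner_smul_left, tinner_smul_right]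
    rw [tinner_comm E₁ E₀]
    ring
  rw [h]
  exact hasDerivAt_quadratic _ _ _

lemma mask_add (S : Set (∀ l, Fin (m l))) (X Y : Tensor m) :
    mask S (X + Y) = mask S X + mask S Y := Set.indicator_add _ _ _

lemma mask_smul (S : Set (∀ l, Fin (m l))) (t : ℝ) (X : Tensor m) :
    mask S (t • X) = t • mask S X := Set.indicator_const_smul S t X

lemma tinner_mask (S : Set (∀ l, Fin (m l))) (X Y : Tensor m) :
    tinner X (mask S Y) = tinner (mask S X) Y := by
  refine Finset.sum_congr rfl fun i _ => ?_
  by_cases h : i ∈ S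
  · rw [mask_apply_mem h, mask_apply_mem h]
  · rw [mask_apply_notMem h, mask_apply_notMem h, mul_zero, zero_mul]

lemma tinner_single (X : Tensor m) (i : ∀ l, Fin (m l)) : tinner X (Pi.single i 1) = X i := by
  simp [tinner, Pi.single_apply]

lemma minner_zero_left {a b : ℕ} (C : Matrix (Fin a) (Fin b) ℝ) : minner 0 C = 0 := by
  simp [minner]

lemma minner_zero_right {a b : ℕ} (C : Matrix (Fin a) (Fin b) ℝ) : minner C 0 = 0 := by
  simp [minner]

lemma lagrangian_zero (Ω : Set (∀ l, Fin (m l))) (M : Tensor m) (A : MatFamily m r)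
    (X Y : Tensor m) :
    lagrangian Ω M (A, X, 0, Y) = objective A X + tinner Y (mask Ω X - mask Ω M) := by
  simp [lagrangian, minner_zero_left]

lemma lagrangian_of_feasible {Ω : Set (∀ l, Fin (m l))} {M : Tensor m} {A : MatFamily m r}
    {X : Tensor m} (hA : ∀ n, (A n)ᵀ * A n = 1) (hX : mask Ω X = mask Ω M) (Λ : MatFamily r r)
    (Y : Tensor m) : lagrangian Ω M (A, X, Λ, Y) = objective A X := by
  simp [lagrangian, hA, minner_zero_right, hX, tinner]

/-- Along this line the matricized residual is quadratic in `t`, because `W` does not involve `A n`.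
The direction `H` is arbitrary, yet the derivative only sees its part orthogonal to the range of `A
n`; hence zero multipliers `Λ` suffice for the gradient. -/
lemma hasDerivAt_objective_factor (X : Tensor m) {A : MatFamily m r}
    (hA : ∀ n, (A n)ᵀ * A n = 1) (n : Fin N) (H : Matrix (Fin (m n)) (Fin (r n)) ℝ) :
    HasDerivAt (fun t : ℝ => objective (A + t • (Pi.single n H : MatFamily m r)) X)
      (-((1 - A n * (A n)ᵀ) * (gMat n X A * (gMat n X A)ᵀ) * A n * Hᵀ).trace) 0 := by
  set W := gMat n X A * (kron n A)ᵀ with hW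
  have hWW : W * Wᵀ = gMat n X A * (gMat n X A)ᵀ := by
    rw [hW, Matrix.transpose_mul, Matrix.transpose_transpose, Matrix.mul_assoc,
      ← Matrix.mul_assoc (kron n A)ᵀ, kron_orthonormal n hA, Matrix.one_mul]
  have hXW : matricize n X * Wᵀ = gMat n X A * (gMat n X A)ᵀ := by
    rw [hW, Matrix.transpose_mul, Matrix.transpose_transpose, ← Matrix.mul_assoc, ← gMat_eq]
  have hfun : (fun t : ℝ => objective (A + t • (Pi.single n H : MatFamily m r)) X) = fun t => 1 / 2 *
      frobSq ((A n * (A n)ᵀ * W - matricize n X) + t • ((H * (A n)ᵀ + A n * Hᵀ) * W) +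
        t ^ 2 • (H * Hᵀ * W)) := by
    ext t
    have hne : ∀ l, l ≠ n → (A + t • (Pi.single n H : MatFamily m r)) l = A l := by
      intro l hl
      simp [Pi.single_eq_of_ne hl]
    have heq : (A + t • (Pi.single n H : MatFamily m r)) n = A n + t • H := by simp
    rw [objective, tinner_eq_trace n, ← frobSq_eq_trace, matricize_sub, matricize_compress,
      gMat_congr hne, kron_congr hne, heq, ← hW]
    congr 2
    simp only [Matrix.transpose_add, Matrix.transpose_smul, Matrix.add_mul, Matrix.mul_add,
      Matrix.smul_mul, Matrix.mul_smul, smul_add, smul_smul, sq]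
    abel
  rw [hfun]
  refine ((hasDerivAt_frobSq _ _ _).const_mul (1 / 2 : ℝ)).congr_deriv ?_
  have e : (A n * (A n)ᵀ * W - matricize n X) * ((H * (A n)ᵀ + A n * Hᵀ) * W)ᵀ =
      -((1 - A n * (A n)ᵀ) * (gMat n X A * (gMat n X A)ᵀ) * (A n * Hᵀ + H * (A n)ᵀ)) := by
    rw [Matrix.transpose_mul, ← Matrix.mul_assoc, Matrix.sub_mul, Matrix.mul_assoc _ W, hWW, hXW,
      Matrix.sub_mul 1, Matrix.one_mul, ← Matrix.neg_mul, neg_sub]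
    simp
  have hz : ((1 - A n * (A n)ᵀ) * (gMat n X A * (gMat n X A)ᵀ) * (H * (A n)ᵀ)).trace = 0 := by
    have hA0 : (A n)ᵀ * (1 - A n * (A n)ᵀ) = 0 := by
      rw [Matrix.mul_sub, ← Matrix.mul_assoc, hA, Matrix.one_mul, Matrix.mul_one, sub_self]
    rw [← Matrix.mul_assoc, Matrix.trace_mul_comm, ← Matrix.mul_assoc, ← Matrix.mul_assoc, hA0,
      Matrix.zero_mul, Matrix.zero_mul, Matrix.trace_zero]
  rw [e, Matrix.trace_neg, Matrix.mul_add, Matrix.trace_add, hz, ← Matrix.mul_assoc]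
  ring

lemma trace_mul_single_transpose {a b : ℕ} (R : Matrix (Fin a) (Fin b) ℝ) (i : Fin a)
    (j : Fin b) : (R * (Matrix.single i j (1 : ℝ))ᵀ).trace = R i j := by
  rw [Matrix.transpose_single, Matrix.trace_mul_single]
  simp

lemma hasDerivAt_objective_tensor (X D : Tensor m) {A : MatFamily m r}
    (hA : ∀ n, (A n)ᵀ * A n = 1) :
    HasDerivAt (fun t : ℝ => objective A (X + t • D)) (tinner (X - compress X A) D) 0 := by
  have hfun : (fun t : ℝ => objective A (X + t • D)) = fun t => 1 / 2 *
      tinner ((compress X A - X) + t • (compress D A - D))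
        ((compress X A - X) + t • (compress D A - D)) := by
    ext t
    rw [objective, compress_add, compress_smul, add_sub_add_comm, smul_sub]
  rw [hfun]
  refine ((hasDerivAt_tinner _ _).const_mul (1 / 2 : ℝ)).congr_deriv ?_
  rw [tinner_sub_right, ← tinner_compress, compress_sub, compress_compress _ hA, sub_self,
    ← neg_sub X, ← neg_one_smul ℝ (X - _), tinner_smul_left]
  simp [tinner]

/-- The gradient of the Lagrangian at a feasible point, with vanishing multipliers of the
orthonormality constraints. -/
lemma gradLagrangian_eq {Ω : Set (∀ l, Fin (m l))} {M : Tensor m} {A : MatFamily m r}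
    {X : Tensor m} (hA : ∀ n, (A n)ᵀ * A n = 1) (hX : mask Ω X = mask Ω M) (Y : Tensor m) :
    gradLagrangian Ω M (A, X, 0, Y) =
      (fun n => -((1 - A n * (A n)ᵀ) * (gMat n X A * (gMat n X A)ᵀ) * A n),
        X - compress X A + mask Ω Y, 0, 0) := by
  refine Prod.ext ?_ (Prod.ext ?_ (Prod.ext ?_ ?_))
  · ext n i j
    simp only [gradLagrangian, Matrix.of_apply, lineDeriv, Matrix.neg_apply]
    have hfun : (fun t : ℝ => lagrangian Ω M
        ((A, X, 0, Y) + t • ((Pi.single n (Matrix.single i j 1), 0, 0, 0) : PrimalDual m r))) =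
        fun t => objective (A + t • (Pi.single n (Matrix.single i j 1) : MatFamily m r)) X := by
      ext t
      simp only [Prod.mk_add_mk, Prod.smul_mk, smul_zero, add_zero, lagrangian_zero, hX, sub_self]
      simp [tinner]
    rw [hfun, (hasDerivAt_objective_factor X hA n _).deriv, trace_mul_single_transpose]
  · ext i
    simp only [gradLagrangian, lineDeriv]
    have hfun : (fun t : ℝ => lagrangian Ω M
        ((A, X, 0, Y) + t • ((0, Pi.single i 1, 0, 0) : PrimalDual m r))) =
        fun t => objective A (X + t • Pi.single i 1) + t * (mask Ω Y) i := by
      ext t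
      simp only [Prod.mk_add_mk, Prod.smul_mk, smul_zero, add_zero, lagrangian_zero, mask_add,
        mask_smul, hX, add_sub_cancel_left, tinner_smul_right, tinner_mask, tinner_single]
    rw [hfun]
    have := (hasDerivAt_objective_tensor X (Pi.single i 1) hA).add
      ((hasDerivAt_id (0 : ℝ)).mul_const (mask Ω Y i))
    refine (HasDerivAt.deriv this).trans ?_
    rw [tinner_single, one_mul]
    rfl
  -- At a feasible point both constraint terms vanish, so the Lagrangian is constant in the
  -- multipliers.
  · ext n i j
    simp only [gradLagrangian, lineDeriv, Matrix.of_apply, Prod.mk_add_mk, Prod.smul_mk, smul_zero,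
      add_zero, lagrangian_of_feasible hA hX, deriv_const]
    rfl
  · ext i
    simp only [gradLagrangian, lineDeriv, Prod.mk_add_mk, Prod.smul_mk, smul_zero, add_zero,
      lagrangian_of_feasible hA hX, deriv_const]
    rfl

/-! ### Asymptotic stationarity -/

namespace IsIHOOI

variable {Ω : Set (∀ l, Fin (m l))} {M : Tensor m} {A : ℕ → MatFamily m r} {X : ℕ → Tensor m}

/-- If the missing entries stay bounded, then convergence may be tested along ultrafilters along
which the iterates converge, to a stationary point. -/
lemma tendsto_of_bounded (h : IsIHOOI Ω M A X)
    (hgap : ∀ n, limsup (fun k => sigma (gIter A X k n) (r n + 1) / sigma (gIter A X k n) (r n))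
      atTop < 1)
    (hb : Bornology.IsBounded (Set.range fun k => mask Ωᶜ (X k)))
    {F : Type*} [TopologicalSpace F] {Ψ : ℕ → F} {c : F}
    (H : ∀ (g : Ultrafilter ℕ) (B : MatFamily m r) (Y : Tensor m), Tendsto A g (𝓝 B) →
      Tendsto X g (𝓝 Y) → IsStationary Ω M B Y → Tendsto Ψ g (𝓝 c)) :
    Tendsto Ψ atTop (𝓝 c) := by
  rw [tendsto_iff_ultrafilter]
  intro g hg
  obtain ⟨K, hK, hKA⟩ := exists_isCompact_orthonormal m r
  obtain ⟨B, -, hB⟩ := hK.ultrafilter_le_nhds (g.map A)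
    (le_principal_iff.2 (Ultrafilter.mem_map.2 (univ_mem' fun k => hKA _ (h.orthonormal k))))
  obtain ⟨Y, -, hY⟩ := hb.isCompact_closure.ultrafilter_le_nhds
    (g.map fun k => mask Ωᶜ (X k)) (le_principal_iff.2 (Ultrafilter.mem_map.2
      (univ_mem' fun k => subset_closure (Set.mem_range_self k))))
  have hA : Tendsto A g (𝓝 B) := hB
  have hX : Tendsto X g (𝓝 (mask Ω M + Y)) := by
    have hY' : Tendsto (fun k => mask Ωᶜ (X k)) g (𝓝 Y) := hY
    refine (hY'.const_add (mask Ω M)).congr fun k => ?_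
    rw [← h.mask_eq k, mask_add_mask_compl]
  refine H g B _ hA hX (h.isStationary hgap (mapClusterPt_iff_ultrafilter.2 ⟨g, hg, ?_⟩))
  exact hA.prodMk_nhds hX

lemma asymptoticallyStationary (h : IsIHOOI Ω M A X)
    (hgap : ∀ n, limsup (fun k => sigma (gIter A X k n) (r n + 1) / sigma (gIter A X k n) (r n))
      atTop < 1)
    (hb : Bornology.IsBounded (Set.range fun k => mask Ωᶜ (X k))) :
    AsymptoticallyStationary Ω M A X := by
  have gram : ∀ {g : Ultrafilter ℕ} {B : MatFamily m r} {Y : Tensor m}, Tendsto A g (𝓝 B) →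
      Tendsto X g (𝓝 Y) → ∀ n : Fin N,
      Tendsto (fun k => gMat n (X k) (A k) * (gMat n (X k) (A k))ᵀ) g
        (𝓝 (gMat n Y B * (gMat n Y B)ᵀ)) := fun hA hX n =>
    tendsto_matrix_mul (tendsto_gMat hA hX n) (tendsto_matrix_transpose (tendsto_gMat hA hX n))
  have obs : ∀ {g : Ultrafilter ℕ} {B : MatFamily m r} {Y : Tensor m}, Tendsto A g (𝓝 B) →
      Tendsto X g (𝓝 Y) → Tendsto (fun k => X k - compress (X k) (A k) +
        mask Ω (obsMultiplier (A k) (X k))) g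
        (𝓝 (Y - compress Y B + mask Ω (obsMultiplier B Y))) := fun hA hX =>
    (hX.sub (tendsto_compress hA hX)).add
      (((continuous_mask Ω).tendsto _).comp ((tendsto_compress hA hX).sub hX))
  -- The gradient of `g` in `A_n` already contains the factor `1 - A_n A_nᵀ`, so `Λ = 0`; in the KKT
  -- residual `factorMultiplier` has to supply this projection.
  refine ⟨⟨fun _ => 0, fun k => obsMultiplier (A k) (X k), fun _ _ => Matrix.isSymm_zero, ?_⟩,
    ⟨fun k => factorMultiplier (A k) (X k), fun k => obsMultiplier (A k) (X k),
      fun k n => isSymm_factorMultiplier _ _ n, ?_⟩⟩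
  · refine h.tendsto_of_bounded hgap hb fun g B Y hA hX hBY => ?_
    simp only [gradLagrangian_eq (h.orthonormal _) (h.mask_eq _)]
    refine Tendsto.prodMk_nhds (tendsto_pi_nhds.2 fun n => ?_) (Tendsto.prodMk_nhds ?_
      (Tendsto.prodMk_nhds tendsto_const_nhds tendsto_const_nhds))
    · have hn := tendsto_pi_nhds.1 hA n
      have hT := (tendsto_matrix_mul (tendsto_matrix_mul ((tendsto_const_nhds (x := 1)).sub
        (tendsto_matrix_mul hn (tendsto_matrix_transpose hn))) (gram hA hX n)) hn).neg
      rw [hBY.factor n, neg_zero] at hT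
      exact hT
    · have hT := obs hA hX
      rw [hBY.add_mask_obsMultiplier] at hT
      exact hT
  · refine h.tendsto_of_bounded hgap hb fun g B Y hA hX hBY => ?_
    have hn : ∀ n, Tendsto (fun k => A k n) g (𝓝 (B n)) := tendsto_pi_nhds.1 hA
    rw [← hBY.kktResidual_eq_zero]
    refine Tendsto.prodMk_nhds (tendsto_pi_nhds.2 fun n => ?_) (Tendsto.prodMk_nhds (obs hA hX)
      (Tendsto.prodMk_nhds (tendsto_pi_nhds.2 fun n => ?_) ?_))
    · exact (tendsto_matrix_mul (gram hA hX n) (hn n)).sub (tendsto_matrix_mul (hn n)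
        (tendsto_matrix_mul (tendsto_matrix_mul (tendsto_matrix_transpose (hn n)) (gram hA hX n))
          (hn n)))
    · exact (tendsto_matrix_mul (tendsto_matrix_transpose (hn n)) (hn n)).sub tendsto_const_nhds
    · exact (((continuous_mask Ω).tendsto Y).comp hX).sub tendsto_const_nhds

end IsIHOOI

lemma IsStationary.exists_isKKT {Ω : Set (∀ l, Fin (m l))} {M : Tensor m} {A : MatFamily m r}
    {X : Tensor m} (h : IsStationary Ω M A X) :
    ∃ (Λ : MatFamily r r) (Y : Tensor m), IsKKT Ω M A X Λ Y :=
  ⟨factorMultiplier A X, obsMultiplier A X, isSymm_factorMultiplier A X, h.kktResidual_eq_zero⟩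

end IHOOI

end

theorem theorem1 {N : ℕ} (m r : Fin N → ℕ) (hr : ∀ n, 1 ≤ r n)
    (Ω : Set (∀ l, Fin (m l))) (M : IHOOI.Tensor m)
    (A : ℕ → IHOOI.MatFamily m r) (X : ℕ → IHOOI.Tensor m)
    (hAX : IHOOI.IsIHOOI Ω M A X)
    (hgap : ∀ n, limsup (fun k => IHOOI.sigma (IHOOI.gIter A X k n) (r n + 1) /
      IHOOI.sigma (IHOOI.gIter A X k n) (r n)) atTop < 1) :
    (∀ (Abar : IHOOI.MatFamily m r) (Xbar : IHOOI.Tensor m),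
      MapClusterPt (Abar, Xbar) atTop (fun k => (A k, X k)) →
      ∃ (Λbar : IHOOI.MatFamily r r) (Ybar : IHOOI.Tensor m),
        IHOOI.IsKKT Ω M Abar Xbar Λbar Ybar) ∧
    (Bornology.IsBounded (Set.range fun k => IHOOI.mask Ωᶜ (X k)) →
      IHOOI.AsymptoticallyStationary Ω M A X) ∧
    (Ω = Set.univ →
      (∀ k, X k = M) ∧
      (∀ Abar : IHOOI.MatFamily m r, MapClusterPt Abar atTop A →
        ∃ (Λbar : IHOOI.MatFamily r r) (Ybar : IHOOI.Tensor m),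
          IHOOI.IsKKT Ω M Abar M Λbar Ybar) ∧
      IHOOI.AsymptoticallyStationary Ω M A X) := by
  refine ⟨fun _ _ h => (hAX.isStationary hgap h).exists_isKKT,
    hAX.asymptoticallyStationary hgap, fun hΩ => ?_⟩
  have hX : ∀ k, X k = M := fun k => by
    have h := hAX.mask_eq k
    simpa only [IHOOI.mask, hΩ, Set.indicator_univ] using h
  refine ⟨hX, fun Abar h => ?_, hAX.asymptoticallyStationary hgap ?_⟩
  · obtain ⟨g, hg, hA⟩ := mapClusterPt_iff_ultrafilter.1 h
    refine (hAX.isStationary hgap (mapClusterPt_iff_ultrafilter.2 ⟨g, hg, ?_⟩)).exists_isKKT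
    -- As `X k` is constantly `M`, a limit point of the factors alone is one of the pairs.
    exact hA.prodMk_nhds (tendsto_const_nhds.congr fun k => (hX k).symm)
  · simp only [hX]
    exact (Set.finite_range_const).isBounded
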